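/- Let $\lambda_p$ be a nonzero real number and let $A=\mathbb{C}_\lambda[S^2]$ be the (non-reduced) fuzzy sphere, i.e. the unital complex algebra with generators $x_1,x_2,x_3$ and relations $[x_i,x_j]=2\imath\lambda_p\,\epsilon_{ijk}x_k$, $\sum_i x_i^2=1-\lambda_p^2$ (repeated indices are summed). Let $\Omega^1$ be the free bimodule with central basis $s^1,s^2,s^3$ and differential $\mathrm{d}a=(\partial_i a)s^i$, $\partial_i=\frac{1}{2\imath\lambda_p}[x_i,\ ]$ (so $\mathrm{d}x_i=\epsilon_{ijk}x_js^k$). Let $\mathcal{S}$ be the free $A$-bimodule with central basis $e^1,e^2$, with Clifford action $s^i\triangleright e^\alpha=\sigma^{i\alpha}{}_\beta e^\beta$ given by the Pauli matrices and with spinor connection $\nabla_{\mathcal S}(a e^\alpha)=\mathrm{d}a\otimes e^\alpha+\frac{\imath}{4}a\,\sigma^{i\alpha}{}_\beta\, s^i\otimes e^\beta$. The Dirac operator for the round metric is $D=\triangleright\circ\nabla_{\mathcal S}:\mathcal S\to\mathcal S$, that is $$D(\psi_\alpha e^\alpha)=\Big(\partial_i\psi_\beta\,\sigma^{i\beta}{}_\alpha+\tfrac{3\imath}{4}\psi_\alpha\Big)e^\alpha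 .$$ For $l=0,1,2,\dots$ let $A_l\subset A$ be the space of elements $f_{i_1\cdots i_l}x_{i_1}\cdots x_{i_l}$ with $f$ totally symmetric and trace free, and let $\mathcal S_l=A_l\otimes\mathbb{C}^2\subset\mathcal S$ be the space of spinors with both components in $A_l$. Let $g\in SU(2)$ act on $A$ by the algebra automorphism $\mathrm{Rot}_g(x_j)=R(g)_{kj}x_k$, where $g\sigma^jg^{-1}=R(g)_{kj}\sigma^k$, and on $\mathcal S$ by $(\psi_1,\psi_2)\mapsto(\mathrm{Rot}_g\psi_1,\mathrm{Rot}_g\psi_2)\,g^{-1}$ (row vectors). A total spin $j$ irreducible is an $SU(2)$-stable subspace on which this representation is irreducible of dimension $2j+1$. Proposition. The operator $\imath D$ on $\mathcal S$ is diagonalisable, i.e. $\mathcal S$ is the direct sum of its eigenspaces. Its eigenvalues are exactly the numbers $$\lambda_{l,\pm}=-\tfrac14\pm\big(l+\tfrac12\big),\qquad l=0,1,2,\dots,$$ where $l=0$ gives only $\lambda_{0,-}$. The eigenspace of $\lambda_{l,\pm}$ has finite dimension $n_{l,\pm}=2l+1\mp1$ and is contained in $\mathcal S_l$. Moreover, for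 each $l$, $\mathcal S_l$ is the direct sum of the eigenspaces of $\lambda_{l,-}$ and $\lambda_{l,+}$; the first is a total spin $l+\frac12$ irreducible and, for $l\ge1$, the second is a total spin $l-\frac12$ irreducible (for $l=0$ it is zero). -/

import Mathlib

noncomputable section

namespace FuzzySphere

open Matrix

/-! ### The fuzzy sphere as an algebra -/

/-- The totally antisymmetric tensor `ε_{ijk}` with `ε_{012} = 1`, as a Vandermonde product. -/
def eps (i j k : Fin 3) : ℂ :=
  (((j : ℕ) : ℂ) - ((i : ℕ) : ℂ)) * (((k : ℕ) : ℂ) - ((i : ℕ) : ℂ)) *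
    (((k : ℕ) : ℂ) - ((j : ℕ) : ℂ)) / 2

/-- Defining relations of the fuzzy sphere: `[x_i, x_j] = 2 i λ_p ε_{ijk} x_k` and
`∑ x_i² = 1 - λ_p²`. -/
inductive Rel (lam : ℝ) : FreeAlgebra ℂ (Fin 3) → FreeAlgebra ℂ (Fin 3) → Prop
  | comm (i j : Fin 3) : Rel lam
      (FreeAlgebra.ι ℂ i * FreeAlgebra.ι ℂ j - FreeAlgebra.ι ℂ j * FreeAlgebra.ι ℂ i)
      (∑ k, (2 * Complex.I * (lam : ℂ) * eps i j k) • FreeAlgebra.ι ℂ k)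
  | radius : Rel lam (∑ i, FreeAlgebra.ι ℂ i * FreeAlgebra.ι ℂ i)
      (algebraMap ℂ (FreeAlgebra ℂ (Fin 3)) (1 - (lam : ℂ) ^ 2))

/-- The (non-reduced) fuzzy sphere `ℂ_λ[S²]`: the unital complex algebra with generators
`x_1, x_2, x_3` and the relations `Rel`. -/
abbrev Alg (lam : ℝ) : Type := RingQuot (Rel lam)

/-- The generators `x_i`. -/
def x (lam : ℝ) (i : Fin 3) : Alg lam :=
  RingQuot.mkAlgHom ℂ (Rel lam) (FreeAlgebra.ι ℂ i)

theorem x_comm (lam : ℝ) (i j : Fin 3) :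
    x lam i * x lam j - x lam j * x lam i =
      ∑ k, (2 * Complex.I * (lam : ℂ) * eps i j k) • x lam k := by
  have h := RingQuot.mkAlgHom_rel ℂ (Rel.comm (lam := lam) i j)
  simpa only [x, map_sub, map_mul, map_sum, map_smul] using h

theorem x_radius (lam : ℝ) :
    ∑ i, x lam i * x lam i = algebraMap ℂ (Alg lam) (1 - (lam : ℂ) ^ 2) := by
  have h := RingQuot.mkAlgHom_rel ℂ (Rel.radius (lam := lam))
  simpa only [x, map_mul, map_sum, AlgHom.commutes] using h

/-! ### The differential calculus -/

/-- The partial derivatives `∂_i = [x_i, · ] / (2 i λ_p)`. -/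
def partialD (lam : ℝ) (i : Fin 3) : Alg lam →ₗ[ℂ] Alg lam :=
  (2 * Complex.I * (lam : ℂ))⁻¹ •
    (LinearMap.mulLeft ℂ (x lam i) - LinearMap.mulRight ℂ (x lam i))

theorem partialD_apply (lam : ℝ) (i : Fin 3) (a : Alg lam) :
    partialD lam i a = (2 * Complex.I * (lam : ℂ))⁻¹ • (x lam i * a - a * x lam i) := by
  simp only [partialD, LinearMap.smul_apply, LinearMap.sub_apply, LinearMap.mulLeft_apply,
    LinearMap.mulRight_apply]

/-- The bimodule `Ω¹` is free with central basis `s^1, s^2, s^3`; a one-form `∑ ω_i s^i` is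
represented by its coefficients `ω_i`, on which the algebra acts from both sides entrywise. -/
abbrev OneForm (lam : ℝ) : Type := Fin 3 → Alg lam

/-- The exterior derivative `d a = (∂_i a) s^i`. -/
def d (lam : ℝ) : Alg lam →ₗ[ℂ] OneForm lam := LinearMap.pi (partialD lam)

/-- The Leibniz rule `d(ab) = (da) b + a (db)`. -/
theorem d_mul (lam : ℝ) (a b : Alg lam) :
    d lam (a * b) = (fun i => d lam a i * b) + (fun i => a * d lam b i) := by
  funext i
  simp only [d, LinearMap.pi_apply, partialD_apply, Pi.add_apply, smul_mul_assoc, mul_smul_comm,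
    ← smul_add]
  congr 1
  simp only [sub_mul, mul_sub, mul_assoc]
  abel

/-- The calculus is the one with `d x_i = ε_{ijk} x_j s^k`. -/
theorem d_x (lam : ℝ) (hlam : lam ≠ 0) (i : Fin 3) :
    d lam (x lam i) = fun k => ∑ j, eps i j k • x lam j := by
  funext k
  have h : (2 * Complex.I * (lam : ℂ)) ≠ 0 := by
    simp [hlam, Complex.I_ne_zero]
  simp only [d, LinearMap.pi_apply, partialD_apply, x_comm, Finset.smul_sum, smul_smul]
  refine Finset.sum_congr rfl fun j _ => ?_
  congr 1
  rw [inv_mul_cancel_left₀ h]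
  simp only [eps]
  ring

/-! ### Spinors and the Dirac operator of the round metric -/

/-- The Pauli matrices; `pauli i α β` is `σ^{i α}_β`. -/
def pauli : Fin 3 → Matrix (Fin 2) (Fin 2) ℂ
  | 0 => !![0, 1; 1, 0]
  | 1 => !![0, -Complex.I; Complex.I, 0]
  | 2 => !![1, 0; 0, -1]

/-- The spinor bimodule `𝒮` is free with central basis `e^1, e^2`; a spinor `∑ ψ_α e^α` is
represented by its coefficients `ψ_α`. -/
abbrev Spinor (lam : ℝ) : Type := Fin 2 → Alg lam

/-- `Ω¹ ⊗_A 𝒮`, free over `A` with central basis `s^i ⊗ e^α`, again through coefficients. -/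
abbrev SpinorForm (lam : ℝ) : Type := Fin 3 → Fin 2 → Alg lam

/-- The spinor connection with `∇ e^α = (i/4) σ^{i α}_β s^i ⊗ e^β`, extended by the left Leibniz
rule `∇(a e^α) = da ⊗ e^α + a ∇ e^α`. -/
def spinConnection (lam : ℝ) : Spinor lam →ₗ[ℂ] SpinorForm lam where
  toFun ψ := fun i α => d lam (ψ α) i + ∑ β, (Complex.I / 4 * pauli i β α) • ψ β
  map_add' ψ φ := by
    funext i α
    simp only [Pi.add_apply, map_add, smul_add, Finset.sum_add_distrib]
    abel
  map_smul' c ψ := by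
    funext i α
    simp only [Pi.smul_apply, map_smul, RingHom.id_apply, smul_add, Finset.smul_sum, smul_comm c]

/-- The Clifford action `s^i ▷ e^α = σ^{i α}_β e^β`, extended left `A`-linearly. -/
def clifford (lam : ℝ) : SpinorForm lam →ₗ[ℂ] Spinor lam where
  toFun ω := fun β => ∑ i, ∑ α, pauli i α β • ω i α
  map_add' ω η := by
    funext β
    simp only [Pi.add_apply, smul_add, Finset.sum_add_distrib]
  map_smul' c ω := by
    funext β
    simp only [Pi.smul_apply, RingHom.id_apply, Finset.smul_sum, smul_comm c]

/-- The geometric Dirac operator `D = ▷ ∘ ∇` on `𝒮`. -/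
def dirac (lam : ℝ) : Module.End ℂ (Spinor lam) := clifford lam ∘ₗ spinConnection lam

/-- The operator `i D`. -/
def iDirac (lam : ℝ) : Module.End ℂ (Spinor lam) := Complex.I • dirac lam

/-- `(D ψ)_α = ∂_i ψ_β σ^{i β}_α + (3 i / 4) ψ_α`. -/
theorem dirac_apply (lam : ℝ) (ψ : Spinor lam) (α : Fin 2) :
    dirac lam ψ α =
      (∑ i, ∑ β, pauli i β α • partialD lam i (ψ β)) + (3 * Complex.I / 4) • ψ α := by
  simp only [dirac, clifford, spinConnection, d, LinearMap.comp_apply, LinearMap.coe_mk,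
    AddHom.coe_mk, LinearMap.pi_apply, Fin.sum_univ_three, Fin.sum_univ_two]
  have hI : Complex.I * (Complex.I * Complex.I) = -Complex.I := by simp
  fin_cases α <;> simp [pauli, smul_smul] <;> match_scalars <;>
    first
      | linear_combination (-(1 : ℂ) / 4) * hI
      | ring

/-! ### Orbital angular momentum -/

/-- Totally symmetric and trace free tensors `f_{i_1 ⋯ i_l}`. -/
def symTraceFree (l : ℕ) : Submodule ℂ ((Fin l → Fin 3) → ℂ) where
  carrier := {f | (∀ (π : Equiv.Perm (Fin l)) (i : Fin l → Fin 3), f (i ∘ π) = f i) ∧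
    ∀ p q : Fin l, p ≠ q → ∀ i : Fin l → Fin 3,
      ∑ k, f (Function.update (Function.update i p k) q k) = 0}
  zero_mem' := by simp
  add_mem' := by
    rintro f g ⟨hf, hf'⟩ ⟨hg, hg'⟩
    refine ⟨fun π i => ?_, fun p q hpq i => ?_⟩
    · simp only [Pi.add_apply, hf, hg]
    · simp only [Pi.add_apply, Finset.sum_add_distrib, hf' p q hpq, hg' p q hpq, add_zero]
  smul_mem' := by
    rintro c f ⟨hf, hf'⟩
    refine ⟨fun π i => ?_, fun p q hpq i => ?_⟩
    · simp only [Pi.smul_apply, hf]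
    · simp only [Pi.smul_apply, ← Finset.smul_sum, hf' p q hpq, smul_zero]

/-- `f ↦ f_{i_1 ⋯ i_l} x_{i_1} ⋯ x_{i_l}`. -/
def tensorEval (lam : ℝ) (l : ℕ) : ((Fin l → Fin 3) → ℂ) →ₗ[ℂ] Alg lam :=
  Fintype.linearCombination ℂ fun i : Fin l → Fin 3 => (List.ofFn fun p => x lam (i p)).prod

/-- The orbital angular momentum `l` subspace `A_l` (noncommutative spherical harmonics). -/
def harmonics (lam : ℝ) (l : ℕ) : Submodule ℂ (Alg lam) :=
  (symTraceFree l).map (tensorEval lam l)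

/-- `𝒮_l = A_l ⊗ ℂ²`: the spinors with both components in `A_l`. -/
def spinorL (lam : ℝ) (l : ℕ) : Submodule ℂ (Spinor lam) :=
  Submodule.pi Set.univ fun _ => harmonics lam l

/-! ### The action of `SU(2)` by rotations -/

theorem sum_smul_mul_sum_smul {B : Type*} [Ring B] [Algebra ℂ B] (u : Fin 3 → B)
    (p q : Fin 3 → ℂ) :
    (∑ a, p a • u a) * ∑ b, q b • u b = ∑ a, ∑ b, (p a * q b) • (u a * u b) := by
  rw [Finset.sum_mul_sum]
  exact Finset.sum_congr rfl fun a _ => Finset.sum_congr rfl fun b _ => smul_mul_smul_comm ..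

theorem sum_smul_commutator {B : Type*} [Ring B] [Algebra ℂ B] (u : Fin 3 → B)
    (p q : Fin 3 → ℂ) :
    (∑ a, p a • u a) * (∑ b, q b • u b) - (∑ b, q b • u b) * (∑ a, p a • u a) =
      ∑ a, ∑ b, (p a * q b) • (u a * u b - u b * u a) := by
  simp only [sum_smul_mul_sum_smul, smul_sub, Finset.sum_sub_distrib]
  congr 1
  rw [Finset.sum_comm]
  exact Finset.sum_congr rfl fun a _ => Finset.sum_congr rfl fun b _ => by rw [mul_comm]

/-- The group `SU(2)`. -/
abbrev SU2 : Type := Matrix.specialUnitaryGroup (Fin 2) ℂ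

/-- The rotation matrix `R(g)` of `g ∈ SU(2)`, i.e. `g σ_j g⁻¹ = ∑_k R(g)_{kj} σ_k`. -/
def rotMatrix (g : SU2) : Matrix (Fin 3) (Fin 3) ℂ :=
  Matrix.of fun k j => (1 / 2 : ℂ) * (pauli k * (g.1 * pauli j * (g⁻¹).1)).trace

theorem pauli_trace (i : Fin 3) : (pauli i).trace = 0 := by
  fin_cases i <;> simp [pauli, Matrix.trace_fin_two]

theorem pauli_mul_trace (i j : Fin 3) :
    (pauli i * pauli j).trace = if i = j then 2 else 0 := by
  fin_cases i <;> fin_cases j <;> simp [pauli, Matrix.trace_fin_two] <;> norm_num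

theorem pauli_commutator (i j : Fin 3) :
    pauli i * pauli j - pauli j * pauli i =
      ∑ k, (2 * Complex.I * eps i j k) • pauli k := by
  fin_cases i <;> fin_cases j <;> ext a b <;> fin_cases a <;> fin_cases b <;>
    simp [pauli, eps, Fin.sum_univ_three] <;> ring_nf <;> simp

theorem pauli_expand (M : Matrix (Fin 2) (Fin 2) ℂ) (hM : M.trace = 0) :
    M = ∑ k, ((1 / 2 : ℂ) * (pauli k * M).trace) • pauli k := by
  rw [Matrix.trace_fin_two] at hM
  ext a b
  fin_cases a <;> fin_cases b <;>
    simp [pauli, Fin.sum_univ_three, Matrix.trace_fin_two, Matrix.mul_apply, Fin.sum_univ_two]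
  · linear_combination (1 / 2 : ℂ) * hM
  · linear_combination (1 / 2 : ℂ) * (M 0 1 - M 1 0) * Complex.I_sq
  · linear_combination (1 / 2 : ℂ) * (M 1 0 - M 0 1) * Complex.I_sq
  · linear_combination (1 / 2 : ℂ) * hM

theorem su2_inv_mul (g : SU2) : (g⁻¹).1 * g.1 = 1 := by
  rw [← Submonoid.coe_mul, inv_mul_cancel]; rfl

theorem su2_mul_inv (g : SU2) : g.1 * (g⁻¹).1 = 1 := by
  rw [← Submonoid.coe_mul, mul_inv_cancel]; rfl

theorem conj_pauli (g : SU2) (j : Fin 3) :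
    g.1 * pauli j * (g⁻¹).1 = ∑ k, rotMatrix g k j • pauli k := by
  refine pauli_expand _ ?_
  rw [Matrix.trace_mul_comm, ← Matrix.mul_assoc, su2_inv_mul, Matrix.one_mul, pauli_trace]

theorem conj_mul (g : SU2) (M N : Matrix (Fin 2) (Fin 2) ℂ) :
    (g.1 * M * (g⁻¹).1) * (g.1 * N * (g⁻¹).1) = g.1 * (M * N) * (g⁻¹).1 := by
  calc _ = g.1 * M * ((g⁻¹).1 * g.1) * N * (g⁻¹).1 := by simp only [Matrix.mul_assoc]
    _ = _ := by rw [su2_inv_mul]; simp only [Matrix.mul_assoc, Matrix.mul_one]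

theorem pauli_coeff (c : Fin 3 → ℂ) (m : Fin 3) :
    (pauli m * ∑ k, c k • pauli k).trace = 2 * c m := by
  simp [Finset.mul_sum, Matrix.trace_sum, pauli_mul_trace, mul_comm]

theorem pauli_inj {c c' : Fin 3 → ℂ} (h : ∑ k, c k • pauli k = ∑ k, c' k • pauli k) :
    c = c' := by
  funext m
  have := congrArg (fun M => (pauli m * M).trace) h
  simpa [pauli_coeff] using this

theorem rotMatrix_one : rotMatrix 1 = 1 := by
  ext k j
  simp [rotMatrix, pauli_mul_trace, Matrix.one_apply]

theorem rotMatrix_mul (g h : SU2) : rotMatrix (g * h) = rotMatrix g * rotMatrix h := by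
  ext k j
  refine congrFun (pauli_inj (c := fun k => rotMatrix (g * h) k j)
    (c' := fun k => (rotMatrix g * rotMatrix h) k j) ?_) k
  rw [← conj_pauli]
  have e : (g * h).1 * pauli j * ((g * h)⁻¹).1 =
      g.1 * (h.1 * pauli j * (h⁻¹).1) * (g⁻¹).1 := by
    rw [_root_.mul_inv_rev]
    simp only [Submonoid.coe_mul, Matrix.mul_assoc]
  rw [e, conj_pauli h]
  simp only [Finset.mul_sum, Finset.sum_mul, Matrix.mul_smul, Matrix.smul_mul, conj_pauli g,
    Finset.smul_sum, smul_smul, Matrix.mul_apply, Finset.sum_smul]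
  rw [Finset.sum_comm]
  simp only [mul_comm]

theorem rotMatrix_transpose_mul (g : SU2) : (rotMatrix g)ᵀ * rotMatrix g = 1 := by
  ext i j
  have h : ((∑ k, rotMatrix g k i • pauli k) * ∑ k, rotMatrix g k j • pauli k).trace =
      if i = j then 2 else 0 := by
    rw [← conj_pauli, ← conj_pauli, conj_mul, Matrix.trace_mul_comm, ← Matrix.mul_assoc,
      su2_inv_mul, Matrix.one_mul, pauli_mul_trace]
  rw [Finset.sum_mul, Matrix.trace_sum] at h
  simp only [Matrix.smul_mul, Matrix.trace_smul, pauli_coeff, smul_eq_mul] at h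
  have h2 : 2 * ∑ k, rotMatrix g k i * rotMatrix g k j = if i = j then 2 else 0 := by
    rw [← h, Finset.mul_sum]
    exact Finset.sum_congr rfl fun k _ => by ring
  rw [Matrix.mul_apply, Matrix.one_apply]
  simp only [Matrix.transpose_apply]
  split_ifs at h2 ⊢ <;> linear_combination h2 / 2

theorem rotMatrix_mul_transpose (g : SU2) : rotMatrix g * (rotMatrix g)ᵀ = 1 :=
  mul_eq_one_comm.mp (rotMatrix_transpose_mul g)

/-- `R(g)` preserves the tensor `ε`. -/
theorem rotMatrix_eps (g : SU2) (i j c : Fin 3) :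
    ∑ a, ∑ b, rotMatrix g a i * rotMatrix g b j * eps a b c =
      ∑ k, eps i j k * rotMatrix g c k := by
  have h : g.1 * (pauli i * pauli j - pauli j * pauli i) * (g⁻¹).1 =
      ∑ a, ∑ b, (rotMatrix g a i * rotMatrix g b j) •
        (pauli a * pauli b - pauli b * pauli a) := by
    rw [Matrix.mul_sub, Matrix.sub_mul, ← conj_mul, ← conj_mul, conj_pauli, conj_pauli,
      sum_smul_commutator]
  simp only [pauli_commutator, Finset.mul_sum, Finset.sum_mul, Matrix.mul_smul, Matrix.smul_mul,
    conj_pauli g, Finset.smul_sum, smul_smul] at h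
  have hc := congrArg (fun M => (pauli c * M).trace) h
  simp only [Finset.mul_sum, Matrix.trace_sum, Matrix.mul_smul, Matrix.trace_smul,
    pauli_mul_trace, smul_eq_mul, mul_ite, mul_zero, Finset.sum_ite_eq, Finset.mem_univ,
    if_true] at hc
  have hI : (4 * Complex.I) ≠ 0 := by simp [Complex.I_ne_zero]
  apply mul_left_cancel₀ hI
  simp only [Finset.mul_sum]
  refine Eq.trans ?_ (hc.symm.trans ?_)
  · exact Finset.sum_congr rfl fun a _ => Finset.sum_congr rfl fun b _ => by ring
  · exact Finset.sum_congr rfl fun a _ => by ring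

/-- The images `R(g)_{kj} x_k` of the generators. -/
def rotGen (lam : ℝ) (g : SU2) (j : Fin 3) : Alg lam := ∑ k, rotMatrix g k j • x lam k

theorem rotGen_comm (lam : ℝ) (g : SU2) (i j : Fin 3) :
    rotGen lam g i * rotGen lam g j - rotGen lam g j * rotGen lam g i =
      ∑ k, (2 * Complex.I * (lam : ℂ) * eps i j k) • rotGen lam g k := by
  have h : rotGen lam g i * rotGen lam g j - rotGen lam g j * rotGen lam g i =
      ∑ a, ∑ b, (rotMatrix g a i * rotMatrix g b j) •
        (x lam a * x lam b - x lam b * x lam a) :=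
    sum_smul_commutator ..
  rw [h]
  have e : ∀ a b : Fin 3, (rotMatrix g a i * rotMatrix g b j) •
      (x lam a * x lam b - x lam b * x lam a) =
      ∑ c, (2 * Complex.I * (lam : ℂ) * (rotMatrix g a i * rotMatrix g b j * eps a b c)) •
        x lam c := by
    intro a b
    rw [x_comm, Finset.smul_sum]
    exact Finset.sum_congr rfl fun c _ => by rw [smul_smul]; congr 1; ring
  have e' : ∑ k, (2 * Complex.I * (lam : ℂ) * eps i j k) • rotGen lam g k =
      ∑ c, (2 * Complex.I * (lam : ℂ) * ∑ k, eps i j k * rotMatrix g c k) • x lam c := by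
    simp only [rotGen, Finset.smul_sum, smul_smul, Finset.mul_sum, Finset.sum_smul]
    rw [Finset.sum_comm]
    simp only [mul_assoc]
  rw [e']
  simp only [e, ← rotMatrix_eps, Finset.mul_sum, Finset.sum_smul]
  exact (Finset.sum_congr rfl fun a _ => Finset.sum_comm).trans Finset.sum_comm

theorem rotGen_radius (lam : ℝ) (g : SU2) :
    ∑ i, rotGen lam g i * rotGen lam g i =
      algebraMap ℂ (Alg lam) (1 - (lam : ℂ) ^ 2) := by
  have hR : ∀ a b : Fin 3, ∑ i, rotMatrix g a i * rotMatrix g b i = if a = b then 1 else 0 := by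
    intro a b
    have := congrFun (congrFun (rotMatrix_mul_transpose g) a) b
    simpa [Matrix.mul_apply, Matrix.one_apply] using this
  have h : ∑ i, rotGen lam g i * rotGen lam g i =
      ∑ a, ∑ b, (∑ i, rotMatrix g a i * rotMatrix g b i) • (x lam a * x lam b) := by
    have hs : ∀ i, rotGen lam g i * rotGen lam g i =
        ∑ a, ∑ b, (rotMatrix g a i * rotMatrix g b i) • (x lam a * x lam b) :=
      fun i => sum_smul_mul_sum_smul ..
    simp only [hs, Finset.sum_smul]
    rw [Finset.sum_comm]
    exact Finset.sum_congr rfl fun a _ => Finset.sum_comm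
  rw [h, ← x_radius]
  simp [hR]

/-- The action of `g ∈ SU(2)` on the fuzzy sphere by algebra automorphisms,
`Rot_g(x_j) = R(g)_{kj} x_k`. -/
def rot (lam : ℝ) (g : SU2) : Alg lam →ₐ[ℂ] Alg lam :=
  RingQuot.liftAlgHom ℂ ⟨FreeAlgebra.lift ℂ (rotGen lam g), by
    rintro _ _ (⟨i, j⟩ | _)
    · simpa only [map_sub, map_mul, map_sum, map_smul, FreeAlgebra.lift_ι_apply] using
        rotGen_comm lam g i j
    · simpa only [map_mul, map_sum, FreeAlgebra.lift_ι_apply, AlgHom.commutes] using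
        rotGen_radius lam g⟩

theorem rot_x (lam : ℝ) (g : SU2) (j : Fin 3) :
    rot lam g (x lam j) = ∑ k, rotMatrix g k j • x lam k := by
  simp only [rot, x, RingQuot.liftAlgHom_mkAlgHom_apply, FreeAlgebra.lift_ι_apply]
  rfl

theorem algHom_ext {lam : ℝ} {B : Type*} [Ring B] [Algebra ℂ B] {f f' : Alg lam →ₐ[ℂ] B}
    (h : ∀ i, f (x lam i) = f' (x lam i)) : f = f' := by
  apply RingQuot.ringQuot_ext'
  apply FreeAlgebra.hom_ext
  funext i
  exact h i

theorem rot_one (lam : ℝ) : rot lam 1 = AlgHom.id ℂ (Alg lam) := by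
  apply algHom_ext
  intro j
  simp [rot_x, rotMatrix_one, Matrix.one_apply]

theorem rot_mul (lam : ℝ) (g h : SU2) : rot lam (g * h) = (rot lam g).comp (rot lam h) := by
  apply algHom_ext
  intro j
  simp only [AlgHom.comp_apply, rot_x, map_sum, map_smul, rotMatrix_mul, Matrix.mul_apply,
    Finset.smul_sum, smul_smul, Finset.sum_smul]
  rw [Finset.sum_comm]
  simp only [mul_comm]

/-- The action of `SU(2)` on spinors by simultaneous rotation of the coefficients in `A` and of
the row vector `(ψ_1, ψ_2)` in spinor space, `g · ψ = Rot_g(ψ) g⁻¹`. -/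
def spinorRep (lam : ℝ) : Representation ℂ SU2 (Spinor lam) where
  toFun g :=
    { toFun := fun ψ α => ∑ β, (g⁻¹).1 β α • rot lam g (ψ β)
      map_add' := by
        intro ψ φ
        funext α
        simp only [Pi.add_apply, map_add, smul_add, Finset.sum_add_distrib]
      map_smul' := by
        intro c ψ
        funext α
        simp only [Pi.smul_apply, map_smul, RingHom.id_apply, Finset.smul_sum, smul_comm c] }
  map_one' := by
    refine LinearMap.ext fun ψ => funext fun α => ?_
    simp [rot_one, Matrix.one_apply]
  map_mul' g h := by
    refine LinearMap.ext fun ψ => funext fun α => ?_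
    simp only [LinearMap.coe_mk, AddHom.coe_mk, Module.End.mul_apply, _root_.mul_inv_rev,
      Submonoid.coe_mul, Matrix.mul_apply, rot_mul, AlgHom.comp_apply, map_sum, map_smul,
      Finset.smul_sum, smul_smul, Finset.sum_smul]
    rw [Finset.sum_comm]
    simp only [mul_comm]

/-- `W ⊆ 𝒮` is a total spin `j` irreducible of `SU(2)`: it is stable under the action of `SU(2)`
on spinors, and the representation on it is irreducible of dimension `2 j + 1`. -/
def IsTotalSpinIrreducible (lam : ℝ) (W : Submodule ℂ (Spinor lam)) (j : ℚ) : Prop :=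
  ∃ σ : Subrepresentation (spinorRep lam), σ.toSubmodule = W ∧
    Representation.IsIrreducible (k := ℂ) (G := SU2) (V := σ.toSubmodule) σ.toRepresentation ∧
    (Module.finrank ℂ W : ℚ) = 2 * j + 1

/-! ### The numbers of the spectrum -/

/-- `λ_{l,±} = -1/4 ± (l + 1/2)`; the sign is a unit `s = ±1` of `ℤ`. -/
def eigenvalue (l : ℕ) (s : ℤˣ) : ℂ := -(1 / 4) + ((s : ℤ) : ℂ) * ((l : ℂ) + 1 / 2)

/-- `n_{l,±} = 2 l + 1 ∓ 1`. -/
def multiplicity (l : ℕ) (s : ℤˣ) : ℤ := 2 * (l : ℤ) + 1 - (s : ℤ)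

end FuzzySphere

end

/-!
The operators `L_i = i ∂_i` satisfy the commutation relations of angular momentum, and so do
`J_i ψ = L_i ψ - ψ σ^i / 2` on spinors. In terms of them `i D = T - 3/4` with the spin-orbit
operator `T ψ = ∑ L_i ψ σ^i`, and the Pauli relations give `T² = L² + T` (`spinOrbit_spinOrbit`) and
`J² = (T - 1)² - 1/4` (`total_casimir`). On `𝒮_l`, where `L² = l (l + 1)`, this reads
`(T + l) (T - l - 1) = 0`, so `𝒮_l` splits into the eigenspaces `T = -l` and `T = l + 1`, that is
`i D = λ_{l,-}` and `i D = λ_{l,+}`, on which `J² = j (j + 1)` with `j = l + 1/2` and `j = l - 1/2`.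

*Dimensions and irreducibility.* A nonzero finite dimensional space stable under the `J_i` on which
`J² = j (j + 1)` has dimension at least `2 j + 1` (`IsLadder.le_finrank`): it contains a vector
killed by `J₊`, whose weight must be `j` or `-j - 1`, and the first `2 j` powers of `J₋` do not kill
it. Neither value of `T` occurs alone on `𝒮_l` (for `l ≥ 1`; only `T = 0` does for `l = 0`), so the
two parts have dimension at least `2 l + 2` and `2 l`; since `dim 𝒮_l ≤ 4 l + 2` these are
equalities (`finrank_spinEigen`). The same bound applied to an `SU(2)`-stable subspace of an
eigenspace shows that the latter is irreducible. That stability under the group implies stability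
under the `J_i` is proved by differentiating along `exp(i t σ_k)`; since the coefficients of the
curves are trigonometric polynomials, no topology is needed on the algebra (`HasVelocity`).

*The harmonics.* It remains to see that `A_l` has dimension `2 l + 1`, that `L² = l (l + 1)` on it,
and that the `A_l` span the algebra. A symmetric trace free tensor is determined by its `2 l + 1`
components with sorted indices of which at most one has the largest value, so `dim A_l ≤ 2 l + 1`.
On the other hand `A_l` contains the powers `(n_i x_i)^l` with `n` null; their span is stable under
rotations, hence under the `L_i`, and contains `K₊^l`, where `K₊` is a multiple of `x_1 + i x_2`. This is a
vector of highest weight `l`, nonzero because the algebra acts by weighted shifts on functions on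
`ℤ` (`shiftRep`), so it generates `2 l + 1` independent vectors, which therefore span `A_l`
(`span_pow_eq_harmonics`). Finally the elements of degree at most `N` are spanned by the `(N + 1)²`
monomials `K₃^k K_±^m` with `k + m ≤ N`, and the independent subspaces `A_0, …, A_N` already fill
up that dimension (`iSup_harmonics_eq_filtration`).
-/

noncomputable section

namespace FuzzySphere

open Matrix

/-! ### Ladder operators -/

section Ladder

variable {V : Type*} [AddCommGroup V] [Module ℂ V]

/-- Angular momentum operators `L₃, L₊, L₋` on a complex vector space, normalised so that `L₊` and
`L₋` shift the eigenvalues of `L₃` by `1`. -/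
structure IsLadder (L₃ Lp Lm : Module.End ℂ V) : Prop where
  raise (v : V) : L₃ (Lp v) = Lp (L₃ v) + Lp v
  lower (v : V) : L₃ (Lm v) = Lm (L₃ v) - Lm v
  comm (v : V) : Lp (Lm v) = Lm (Lp v) + (2 : ℂ) • L₃ v

namespace IsLadder

variable {L₃ Lp Lm : Module.End ℂ V}

theorem weight_pow (h : IsLadder L₃ Lp Lm) {m : ℂ} {v : V} (hv : L₃ v = m • v) (k : ℕ) :
    L₃ ((Lm ^ k) v) = (m - k) • (Lm ^ k) v := by
  induction k with
  | zero => simpa using hv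
  | succ k ih =>
    rw [pow_succ', Module.End.mul_apply, h.lower, ih, map_smul]
    push_cast
    module

theorem raise_pow (h : IsLadder L₃ Lp Lm) {m : ℂ} {v : V} (hv : L₃ v = m • v) (hp : Lp v = 0)
    (k : ℕ) :
    Lp ((Lm ^ (k + 1)) v) = ((k + 1) * (2 * m - k) : ℂ) • (Lm ^ k) v := by
  induction k with
  | zero => simp [h.comm, hp, hv, smul_smul]
  | succ k ih =>
    rw [pow_succ', Module.End.mul_apply, h.comm, ih, h.weight_pow hv, map_smul,
      ← Module.End.mul_apply, ← pow_succ']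
    push_cast
    module

/-- A vector killed by `L₊` whose weight `m` is not one of `0, 1/2, …, (n-1)/2` generates `n + 1`
independent vectors under `L₋`: they have distinct weights, and `L₊` leads back from each of them
to a nonzero multiple of the preceding one. -/
theorem linearIndependent_pow (h : IsLadder L₃ Lp Lm) {m : ℂ} {v : V} (hv0 : v ≠ 0)
    (hv : L₃ v = m • v) (hp : Lp v = 0) (n : ℕ) (hm : ∀ k < n, 2 * m ≠ (k : ℂ)) :
    LinearIndependent ℂ fun k : Fin (n + 1) => (Lm ^ (k : ℕ)) v := by
  have hne : ∀ k ≤ n, (Lm ^ k) v ≠ 0 := by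
    intro k
    induction k with
    | zero => intro _; simpa using hv0
    | succ k ih =>
      intro hk h0
      have h1 := h.raise_pow hv hp k
      rw [h0, map_zero, eq_comm, smul_eq_zero] at h1
      rcases h1 with h1 | h1
      · rcases mul_eq_zero.mp h1 with h2 | h2
        · exact Nat.cast_add_one_ne_zero k h2
        · exact hm k hk (sub_eq_zero.mp h2)
      · exact ih (by omega) h1
  refine Module.End.eigenvectors_linearIndependent' L₃ (fun k : Fin (n + 1) => m - (k : ℕ)) ?_ _ ?_
  · intro a b hab
    have : ((a : ℕ) : ℂ) = (b : ℕ) := sub_right_injective hab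
    exact Fin.ext (Nat.cast_injective this)
  · intro k
    exact ⟨Module.End.mem_eigenspace_iff.mpr (h.weight_pow hv k), hne k (by omega)⟩

/-- An eigenvector of `L₃` in `W` whose eigenvalue has maximal real part is killed by `L₊`. -/
theorem exists_primitive (h : IsLadder L₃ Lp Lm) {W : Submodule ℂ V} [FiniteDimensional ℂ W]
    (hW : W ≠ ⊥) (h3 : ∀ w ∈ W, L₃ w ∈ W) (hp : ∀ w ∈ W, Lp w ∈ W) :
    ∃ v ∈ W, v ≠ 0 ∧ Lp v = 0 ∧ ∃ m : ℂ, L₃ v = m • v := by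
  have : Nontrivial W := Submodule.nontrivial_iff_ne_bot.mpr hW
  set f : Module.End ℂ W := L₃.restrict h3 with hf
  have hfin : {μ : ℂ | f.HasEigenvalue μ}.Finite := Module.End.finite_hasEigenvalue f
  obtain ⟨μ₀, hμ₀⟩ := Module.End.exists_eigenvalue f
  -- an eigenvalue of maximal real part cannot be raised
  obtain ⟨m, hm, hmax⟩ := Set.exists_max_image _ Complex.re hfin ⟨μ₀, hμ₀⟩
  obtain ⟨v, hv⟩ := Module.End.HasEigenvalue.exists_hasEigenvector hm
  have hv3 : L₃ v = m • (v : V) := by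
    simpa [hf] using congrArg Subtype.val hv.apply_eq_smul
  refine ⟨v, v.2, by simpa using hv.2, ?_, m, hv3⟩
  by_contra hne
  have : f.HasEigenvalue (m + 1) := by
    refine Module.End.hasEigenvalue_of_hasEigenvector (x := ⟨Lp v, hp v v.2⟩) ⟨?_, ?_⟩
    · rw [Module.End.mem_eigenspace_iff]
      ext
      simp [hf, h.raise, hv3, add_smul]
    · simpa [Subtype.ext_iff] using hne
  have := hmax _ this
  simp at this
  linarith

/-- A nonzero finite dimensional space of vectors of total spin `n / 2`, stable under the ladder
operators, has dimension at least `n + 1`. -/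
theorem le_finrank (h : IsLadder L₃ Lp Lm) {W : Submodule ℂ V} [FiniteDimensional ℂ W]
    (hW : W ≠ ⊥) (h3 : ∀ w ∈ W, L₃ w ∈ W) (hp : ∀ w ∈ W, Lp w ∈ W) (hm : ∀ w ∈ W, Lm w ∈ W)
    (n : ℕ)
    (hcas : ∀ w ∈ W, Lm (Lp w) + L₃ (L₃ w) + L₃ w = ((n : ℂ) / 2 * (n / 2 + 1)) • w) :
    n + 1 ≤ Module.finrank ℂ W := by
  obtain ⟨v, hvW, hv0, hpv, m, hmv⟩ := h.exists_primitive hW h3 hp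
  have hc := hcas v hvW
  have hc' : (m * (m + 1) - (n : ℂ) / 2 * (n / 2 + 1)) • v = 0 := by
    rw [sub_smul, ← hc, hpv, hmv, map_zero, map_smul, hmv]
    module
  have hm2 : (2 * m - n) * (2 * m + n + 2) = 0 := by
    have := (smul_eq_zero.mp hc').resolve_right hv0
    linear_combination 4 * this
  -- the weight is `n / 2` or `-n / 2 - 1`; either is enough
  have hk : ∀ k < n, 2 * m ≠ (k : ℂ) := by
    intro k hk h2
    rw [h2] at hm2
    rcases mul_eq_zero.mp hm2 with h4 | h4
    · have : (k : ℂ) = n := sub_eq_zero.mp h4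
      exact hk.ne (Nat.cast_injective this)
    · have : ((k + n + 2 : ℕ) : ℂ) = 0 := by push_cast; exact h4
      exact absurd (Nat.cast_eq_zero.mp this) (by omega)
  have hmem : ∀ k : ℕ, (Lm ^ k) v ∈ W := by
    intro k
    induction k with
    | zero => simpa using hvW
    | succ k ih => rw [pow_succ', Module.End.mul_apply]; exact hm _ ih
  have hli := h.linearIndependent_pow hv0 hmv hpv n hk
  have hli' : LinearIndependent ℂ fun k : Fin (n + 1) => (⟨(Lm ^ (k : ℕ)) v, hmem k⟩ : W) :=
    LinearIndependent.of_comp W.subtype hli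
  simpa using hli'.fintype_card_le_finrank

end IsLadder

end Ladder

/-! ### Curves and their velocities -/

section Velocity

variable {V : Type*} [AddCommGroup V] [Module ℂ V]

/-- The curve `γ` in `V` is a finite combination `∑ f_i(t) a_i` of vectors with coefficients
differentiable at `0`, and its velocity `∑ f_i'(0) a_i` is `v`. No topology on `V` is needed. -/
def HasVelocity (γ : ℝ → V) (v : V) : Prop :=
  ∃ (ι : Type) (_ : Fintype ι) (f : ι → ℝ → ℂ) (f' : ι → ℂ) (a : ι → V),
    (∀ i, HasDerivAt (f i) (f' i) 0) ∧ (∀ t, γ t = ∑ i, f i t • a i) ∧ v = ∑ i, f' i • a i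

theorem HasVelocity.smul_const {f : ℝ → ℂ} {f' : ℂ} (hf : HasDerivAt f f' 0) (a : V) :
    HasVelocity (fun t => f t • a) (f' • a) :=
  ⟨Unit, inferInstance, fun _ => f, fun _ => f', fun _ => a, fun _ => hf, by simp, by simp⟩

theorem HasVelocity.const (a : V) : HasVelocity (fun _ => a) 0 := by
  simpa using HasVelocity.smul_const (hasDerivAt_const (0 : ℝ) (1 : ℂ)) a

theorem HasVelocity.add {γ δ : ℝ → V} {v w : V} (hγ : HasVelocity γ v) (hδ : HasVelocity δ w) :
    HasVelocity (fun t => γ t + δ t) (v + w) := by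
  obtain ⟨ι, _, f, f', a, hf, hγ, rfl⟩ := hγ
  obtain ⟨κ, _, g, g', b, hg, hδ, rfl⟩ := hδ
  refine ⟨ι ⊕ κ, inferInstance, Sum.elim f g, Sum.elim f' g', Sum.elim a b, ?_, ?_, ?_⟩
  · rintro (i | i)
    · exact hf i
    · exact hg i
  · intro t
    simp [hγ, hδ]
  · simp

theorem HasVelocity.sum {κ : Type*} (s : Finset κ) {γ : κ → ℝ → V} {v : κ → V}
    (h : ∀ i ∈ s, HasVelocity (γ i) (v i)) :
    HasVelocity (fun t => ∑ i ∈ s, γ i t) (∑ i ∈ s, v i) := by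
  classical
  induction s using Finset.induction_on with
  | empty => simpa using HasVelocity.const (0 : V)
  | insert i s hi ih =>
    simp only [Finset.sum_insert hi]
    exact (h i (by simp)).add (ih fun j hj => h j (by simp [hj]))

theorem HasVelocity.map {W : Type*} [AddCommGroup W] [Module ℂ W] (L : V →ₗ[ℂ] W) {γ : ℝ → V}
    {v : V} (h : HasVelocity γ v) : HasVelocity (fun t => L (γ t)) (L v) := by
  obtain ⟨ι, _, f, f', a, hf, hγ, rfl⟩ := h
  exact ⟨ι, inferInstance, f, f', fun i => L (a i), hf, fun t => by simp [hγ], by simp⟩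

theorem HasVelocity.smul {f : ℝ → ℂ} {f' : ℂ} (hf : HasDerivAt f f' 0) {γ : ℝ → V} {v : V}
    (h : HasVelocity γ v) : HasVelocity (fun t => f t • γ t) (f' • γ 0 + f 0 • v) := by
  obtain ⟨ι, _, g, g', a, hg, hγ, rfl⟩ := h
  refine ⟨ι, inferInstance, fun i t => f t * g i t, fun i => f' * g i 0 + f 0 * g' i, a,
    fun i => hf.mul (hg i), fun t => ?_, ?_⟩
  · simp [hγ, Finset.smul_sum, smul_smul]
  · simp [hγ, Finset.smul_sum, smul_smul, add_smul, Finset.sum_add_distrib]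

theorem HasVelocity.mul {B : Type*} [Ring B] [Algebra ℂ B] {γ δ : ℝ → B} {v w : B}
    (hγ : HasVelocity γ v) (hδ : HasVelocity δ w) :
    HasVelocity (fun t => γ t * δ t) (v * δ 0 + γ 0 * w) := by
  obtain ⟨ι, _, f, f', a, hf, hγ, rfl⟩ := hγ
  obtain ⟨κ, _, g, g', b, hg, hδ, rfl⟩ := hδ
  refine ⟨ι × κ, inferInstance, fun p t => f p.1 t * g p.2 t,
    fun p => f' p.1 * g p.2 0 + f p.1 0 * g' p.2, fun p => a p.1 * b p.2,
    fun p => (hf p.1).mul (hg p.2), fun t => ?_, ?_⟩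
  · simp [hγ, hδ, Fintype.sum_prod_type, Finset.sum_mul_sum, smul_smul, mul_comm]
  · simp [hγ, hδ, Fintype.sum_prod_type, Finset.sum_mul_sum, smul_smul, mul_comm, add_smul,
      Finset.sum_add_distrib]

/-- The velocity of a curve lying in a subspace lies in it too, because every linear form that
vanishes on the subspace has derivative zero along the curve. -/
theorem HasVelocity.mem {γ : ℝ → V} {v : V} (h : HasVelocity γ v) {W : Submodule ℂ V}
    (hW : ∀ t, γ t ∈ W) : v ∈ W := by
  obtain ⟨ι, _, f, f', a, hf, hγ, rfl⟩ := h
  by_contra hv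
  obtain ⟨φ, hφ, hφW⟩ := Submodule.exists_le_ker_of_notMem hv
  apply hφ
  have h1 : HasDerivAt (fun t => ∑ i, f i t * φ (a i)) (∑ i, f' i * φ (a i)) 0 :=
    HasDerivAt.fun_sum fun i _ => (hf i).mul_const _
  have h2 : (fun t => ∑ i, f i t * φ (a i)) = fun _ => 0 := by
    funext t
    have := hφW (hW t)
    rw [LinearMap.mem_ker, hγ] at this
    simpa using this
  rw [h2] at h1
  have h3 := h1.unique (hasDerivAt_const (0 : ℝ) (0 : ℂ))
  simpa using h3

end Velocity

/-! ### Orbital and total angular momentum -/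

section Momentum

variable (lam : ℝ)

/-- The generator `K₃ = x₃ / (2 λ_p)`, normalised so that `K₃, K₊, K₋` satisfy the standard
relations of `𝔰𝔩₂`. The generators `x₁, x₂, x₃` carry the indices `0, 1, 2`. -/
def K3 : Alg lam := (2 * (lam : ℂ))⁻¹ • x lam 2

/-- The generator `K₊ = (x₁ + i x₂) / (2 λ_p)`. -/
def Kp : Alg lam := (2 * (lam : ℂ))⁻¹ • (x lam 0 + Complex.I • x lam 1)

/-- The generator `K₋ = (x₁ - i x₂) / (2 λ_p)`. -/
def Km : Alg lam := (2 * (lam : ℂ))⁻¹ • (x lam 0 - Complex.I • x lam 1)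

/-- The value `(1 - λ_p²) / (4 λ_p²)` of the Casimir element `K₋ K₊ + K₃² + K₃`. -/
def casimir : ℂ := (1 - (lam : ℂ) ^ 2) * ((2 * (lam : ℂ))⁻¹) ^ 2

variable {lam}

theorem x_eq (hlam : lam ≠ 0) :
    x lam 0 = (lam : ℂ) • (Kp lam + Km lam) ∧
      x lam 1 = (-(Complex.I * lam)) • (Kp lam - Km lam) ∧ x lam 2 = (2 * (lam : ℂ)) • K3 lam := by
  have h : (lam : ℂ) ≠ 0 := by exact_mod_cast hlam
  have h2 : (2 * (lam : ℂ)) ≠ 0 := by simp [hlam]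
  refine ⟨?_, ?_, ?_⟩
  · rw [Kp, Km]
    match_scalars <;> field_simp <;> ring
  · rw [Kp, Km]
    match_scalars
    · field_simp
      linear_combination (2 : ℂ) * Complex.I_sq
    · ring
  · rw [K3, smul_smul, mul_inv_cancel₀ h2, one_smul]

theorem x_comm' :
    x lam 0 * x lam 1 = x lam 1 * x lam 0 + (2 * Complex.I * lam) • x lam 2 ∧
    x lam 1 * x lam 2 = x lam 2 * x lam 1 + (2 * Complex.I * lam) • x lam 0 ∧
    x lam 2 * x lam 0 = x lam 0 * x lam 2 + (2 * Complex.I * lam) • x lam 1 := by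
  have h01 := x_comm lam 0 1
  have h12 := x_comm lam 1 2
  have h20 := x_comm lam 2 0
  simp only [Fin.sum_univ_three, eps, Fin.isValue] at h01 h12 h20
  norm_num at h01 h12 h20
  exact ⟨sub_eq_iff_eq_add'.mp h01, sub_eq_iff_eq_add'.mp h12, sub_eq_iff_eq_add'.mp h20⟩

theorem K3_mul_Kp (hlam : lam ≠ 0) : K3 lam * Kp lam = Kp lam * K3 lam + Kp lam := by
  have h : (lam : ℂ) ≠ 0 := by exact_mod_cast hlam
  obtain ⟨-, h12, h20⟩ := x_comm' (lam := lam)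
  simp only [K3, Kp, mul_add, add_mul, mul_smul_comm, smul_mul_assoc, h12, h20]
  match_scalars <;> field_simp
  · linear_combination (-1 : ℂ) * Complex.I_sq

theorem K3_mul_Km (hlam : lam ≠ 0) : K3 lam * Km lam = Km lam * K3 lam - Km lam := by
  have h : (lam : ℂ) ≠ 0 := by exact_mod_cast hlam
  obtain ⟨-, h12, h20⟩ := x_comm' (lam := lam)
  simp only [K3, Km, mul_sub, sub_mul, mul_smul_comm, smul_mul_assoc, h12, h20]
  match_scalars <;> field_simp
  · linear_combination Complex.I_sq

theorem Km_mul_Kp (hlam : lam ≠ 0) :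
    Km lam * Kp lam = algebraMap ℂ _ (casimir lam) - K3 lam * K3 lam - K3 lam := by
  have h : (lam : ℂ) ≠ 0 := by exact_mod_cast hlam
  obtain ⟨h01, -, -⟩ := x_comm' (lam := lam)
  have hr := x_radius lam
  rw [Fin.sum_univ_three, ← eq_sub_iff_add_eq, ← eq_sub_iff_add_eq] at hr
  simp only [K3, Kp, Km, casimir, mul_add, sub_mul, mul_smul_comm,
    smul_mul_assoc, h01, hr, Algebra.algebraMap_eq_smul_one]
  match_scalars <;> field_simp <;> ring_nf <;> simp

theorem Kp_mul_Km (hlam : lam ≠ 0) :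
    Kp lam * Km lam = algebraMap ℂ _ (casimir lam) - K3 lam * K3 lam + K3 lam := by
  have h : (lam : ℂ) ≠ 0 := by exact_mod_cast hlam
  obtain ⟨h01, -, -⟩ := x_comm' (lam := lam)
  have hr := x_radius lam
  rw [Fin.sum_univ_three, ← eq_sub_iff_add_eq, ← eq_sub_iff_add_eq] at hr
  simp only [K3, Kp, Km, casimir, mul_sub, add_mul, mul_smul_comm,
    smul_mul_assoc, h01, hr, Algebra.algebraMap_eq_smul_one]
  match_scalars <;> field_simp <;> ring_nf <;> simp

variable (lam)

/-- The orbital operator `L₃ = [K₃, · ]`. -/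
def L3 : Module.End ℂ (Alg lam) := LinearMap.mulLeft ℂ (K3 lam) - LinearMap.mulRight ℂ (K3 lam)

/-- The orbital operator `L₊ = [K₊, · ]`. -/
def Lp : Module.End ℂ (Alg lam) := LinearMap.mulLeft ℂ (Kp lam) - LinearMap.mulRight ℂ (Kp lam)

/-- The orbital operator `L₋ = [K₋, · ]`. -/
def Lm : Module.End ℂ (Alg lam) := LinearMap.mulLeft ℂ (Km lam) - LinearMap.mulRight ℂ (Km lam)

variable {lam}

theorem L3_apply (a : Alg lam) : L3 lam a = K3 lam * a - a * K3 lam := rfl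

theorem Lp_apply (a : Alg lam) : Lp lam a = Kp lam * a - a * Kp lam := rfl

theorem Lm_apply (a : Alg lam) : Lm lam a = Km lam * a - a * Km lam := rfl

theorem commutator_commutator {B : Type*} [Ring B] {u w z : B} (h : u * w = w * u + z) (a : B) :
    u * (w * a - a * w) - (w * a - a * w) * u =
      w * (u * a - a * u) - (u * a - a * u) * w + (z * a - a * z) := by
  rw [← sub_eq_iff_eq_add'.mpr h]
  noncomm_ring

theorem commutator_commutator_neg {B : Type*} [Ring B] {u w z : B} (h : u * w = w * u - z)
    (a : B) :
    u * (w * a - a * w) - (w * a - a * w) * u =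
      w * (u * a - a * u) - (u * a - a * u) * w - (z * a - a * z) := by
  rw [commutator_commutator (h.trans (sub_eq_add_neg _ _))]
  noncomm_ring

theorem commutator_commutator_smul {B : Type*} [Ring B] [Algebra ℂ B] {u w z : B} {c : ℂ}
    (h : u * w = w * u + c • z) (a : B) :
    u * (w * a - a * w) - (w * a - a * w) * u =
      w * (u * a - a * u) - (u * a - a * u) * w + c • (z * a - a * z) := by
  rw [commutator_commutator h, smul_mul_assoc, mul_smul_comm, smul_sub]

theorem isLadder_orbital (hlam : lam ≠ 0) : IsLadder (L3 lam) (Lp lam) (Lm lam) where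
  raise := commutator_commutator (K3_mul_Kp hlam)
  lower := commutator_commutator_neg (K3_mul_Km hlam)
  comm := by
    have h : Kp lam * Km lam = Km lam * Kp lam + (2 : ℂ) • K3 lam := by
      rw [Kp_mul_Km hlam, Km_mul_Kp hlam]
      module
    exact commutator_commutator_smul h

/-- The derivations in terms of the orbital operators, that is
`∂_i = -i L_i` with `L_± = L₁ ± i L₂`. -/
theorem partialD_eq (a : Alg lam) :
    partialD lam 0 a = (-(Complex.I / 2)) • (Lp lam a + Lm lam a) ∧
      partialD lam 1 a = (-(1 / 2) : ℂ) • (Lp lam a - Lm lam a) ∧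
      partialD lam 2 a = (-Complex.I) • L3 lam a := by
  have hI : (Complex.I)⁻¹ = -Complex.I := Complex.inv_I
  refine ⟨?_, ?_, ?_⟩
  · simp only [partialD_apply, Lp_apply, Lm_apply, Kp, Km, mul_inv, hI, smul_mul_assoc,
      mul_smul_comm, add_mul, sub_mul, mul_add, mul_sub]
    match_scalars <;> ring_nf
  · simp only [partialD_apply, Lp_apply, Lm_apply, Kp, Km, mul_inv, hI, smul_mul_assoc,
      mul_smul_comm, add_mul, sub_mul, mul_add, mul_sub]
    match_scalars <;> ring_nf
  · simp only [partialD_apply, L3_apply, K3, mul_inv, hI, smul_mul_assoc, mul_smul_comm]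
    match_scalars <;> ring_nf

variable (lam) in
/-- The spin-orbit operator `T = ∑ L_i σ^i = i D + 3/4`. -/
def spinOrbit : Module.End ℂ (Spinor lam) := iDirac lam + (3 / 4 : ℂ) • 1

/-- Spinors are row vectors, so `σ^i` acts from the right: `ψ ↦ ψ σ^i`. -/
theorem spinOrbit_apply (ψ : Spinor lam) :
    spinOrbit lam ψ = ![L3 lam (ψ 0) + Lp lam (ψ 1), Lm lam (ψ 0) - L3 lam (ψ 1)] := by
  funext α
  obtain ⟨h00, h01, h02⟩ := partialD_eq (ψ 0)
  obtain ⟨h10, h11, h12⟩ := partialD_eq (ψ 1)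
  simp only [spinOrbit, iDirac, LinearMap.add_apply, LinearMap.smul_apply, Pi.add_apply,
    Pi.smul_apply, dirac_apply, Fin.sum_univ_three, Fin.sum_univ_two, Module.End.one_apply]
  fin_cases α <;> simp [pauli, h00, h01, h02, h10, h11, h12] <;> match_scalars <;> ring_nf <;>
    simp [Complex.I_sq]

variable (lam) in
/-- The total angular momentum `J₃ = L₃ + S₃`, where `S_i ψ = -ψ σ^i / 2`. -/
def J3 : Module.End ℂ (Spinor lam) where
  toFun ψ := ![L3 lam (ψ 0) - (1 / 2 : ℂ) • ψ 0, L3 lam (ψ 1) + (1 / 2 : ℂ) • ψ 1]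
  map_add' ψ φ := by
    funext α; fin_cases α <;> simp <;> module
  map_smul' c ψ := by
    funext α; fin_cases α <;> simp <;> module

variable (lam) in
/-- The total angular momentum raising operator `J₊ = J₁ + i J₂`. -/
def Jp : Module.End ℂ (Spinor lam) where
  toFun ψ := ![Lp lam (ψ 0), Lp lam (ψ 1) - ψ 0]
  map_add' ψ φ := by
    funext α; fin_cases α <;> simp; module
  map_smul' c ψ := by
    funext α; fin_cases α <;> simp; module

variable (lam) in
/-- The total angular momentum lowering operator `J₋ = J₁ - i J₂`. -/
def Jm : Module.End ℂ (Spinor lam) where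
  toFun ψ := ![Lm lam (ψ 0) - ψ 1, Lm lam (ψ 1)]
  map_add' ψ φ := by
    funext α; fin_cases α <;> simp; module
  map_smul' c ψ := by
    funext α; fin_cases α <;> simp; module

theorem J3_apply (ψ : Spinor lam) :
    J3 lam ψ = ![L3 lam (ψ 0) - (1 / 2 : ℂ) • ψ 0, L3 lam (ψ 1) + (1 / 2 : ℂ) • ψ 1] := rfl

theorem Jp_apply (ψ : Spinor lam) : Jp lam ψ = ![Lp lam (ψ 0), Lp lam (ψ 1) - ψ 0] := rfl

theorem Jm_apply (ψ : Spinor lam) : Jm lam ψ = ![Lm lam (ψ 0) - ψ 1, Lm lam (ψ 1)] := rfl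

theorem isLadder_total (hlam : lam ≠ 0) : IsLadder (J3 lam) (Jp lam) (Jm lam) where
  raise ψ := by
    have h := (isLadder_orbital hlam).raise
    funext α
    fin_cases α <;> simp [J3_apply, Jp_apply, h] <;> module
  lower ψ := by
    have h := (isLadder_orbital hlam).lower
    funext α
    fin_cases α <;> simp [J3_apply, Jm_apply, h] <;> module
  comm ψ := by
    have h := (isLadder_orbital hlam).comm
    funext α
    fin_cases α <;> simp [J3_apply, Jp_apply, Jm_apply, h] <;> module

/-- The square `L² = L₋ L₊ + L₃² + L₃` of the orbital angular momentum. -/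
def Lsq (lam : ℝ) : Module.End ℂ (Alg lam) := Lm lam * Lp lam + L3 lam * L3 lam + L3 lam

theorem Lsq_apply (a : Alg lam) :
    Lsq lam a = Lm lam (Lp lam a) + L3 lam (L3 lam a) + L3 lam a := rfl

/-- `T² = L² + T`. -/
theorem spinOrbit_spinOrbit (hlam : lam ≠ 0) (ψ : Spinor lam) :
    spinOrbit lam (spinOrbit lam ψ) = (fun α => Lsq lam (ψ α)) + spinOrbit lam ψ := by
  have h := isLadder_orbital hlam
  funext α
  fin_cases α <;> simp [spinOrbit_apply, Lsq_apply, h.comm, h.raise, h.lower] <;> module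

/-- `J² = (T - 1)² - 1/4`. -/
theorem total_casimir (hlam : lam ≠ 0) (ψ : Spinor lam) :
    Jm lam (Jp lam ψ) + J3 lam (J3 lam ψ) + J3 lam ψ =
      spinOrbit lam (spinOrbit lam ψ) - (2 : ℂ) • spinOrbit lam ψ + (3 / 4 : ℂ) • ψ := by
  have h := isLadder_orbital hlam
  funext α
  fin_cases α <;>
    simp [spinOrbit_apply, Jm_apply, Jp_apply, J3_apply, h.comm, h.raise, h.lower] <;> module

end Momentum

/-! ### One-parameter subgroups of `SU(2)` and their velocities -/

section Rotation

theorem pauli_conjTranspose (k : Fin 3) : (pauli k)ᴴ = pauli k := by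
  ext a b
  fin_cases k <;> fin_cases a <;> fin_cases b <;> simp [pauli]

theorem pauli_mul_self (k : Fin 3) : pauli k * pauli k = 1 := by
  ext a b
  fin_cases k <;> fin_cases a <;> fin_cases b <;> simp [pauli]

theorem su2_coe_inv (g : SU2) : (g⁻¹).1 = (g.1)ᴴ := rfl

/-- The matrix `exp(i t σ_k) = cos t + i sin t σ_k`. -/
def expPauli (k : Fin 3) (t : ℝ) : SU2 :=
  ⟨(Real.cos t : ℂ) • 1 + (Complex.I * Real.sin t) • pauli k, by
    have hcs : (Real.cos t : ℂ) * Real.cos t + Real.sin t * Real.sin t = 1 := by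
      have := Real.cos_sq_add_sin_sq t
      exact_mod_cast (by linarith : Real.cos t * Real.cos t + Real.sin t * Real.sin t = 1)
    rw [Matrix.mem_specialUnitaryGroup_iff]
    constructor
    · rw [Matrix.mem_unitaryGroup_iff]
      simp only [star_eq_conjTranspose, conjTranspose_add, conjTranspose_smul, conjTranspose_one,
        pauli_conjTranspose, mul_add, add_mul, smul_mul_smul_comm, pauli_mul_self, one_mul, mul_one,
        star_mul', Complex.star_def, Complex.conj_ofReal, Complex.conj_I]
      rw [← one_smul ℂ (1 : Matrix (Fin 2) (Fin 2) ℂ)]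
      generalize (Real.cos t : ℂ) = c at hcs ⊢
      generalize (Real.sin t : ℂ) = s at hcs ⊢
      match_scalars
      · linear_combination hcs - s * s * Complex.I_sq
      · ring
    · have hI := Complex.I_sq
      generalize (Real.cos t : ℂ) = c at hcs ⊢
      generalize (Real.sin t : ℂ) = s at hcs ⊢
      fin_cases k <;> simp [pauli, Matrix.det_fin_two]
      · linear_combination hcs - s * s * hI
      · linear_combination hcs + (-s * s + Complex.I ^ 2 * s * s) * hI
      · linear_combination hcs - s * s * hI⟩

theorem expPauli_coe (k : Fin 3) (t : ℝ) :
    (expPauli k t).1 = (Real.cos t : ℂ) • 1 + (Complex.I * Real.sin t) • pauli k := rfl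

theorem expPauli_inv_coe (k : Fin 3) (t : ℝ) :
    ((expPauli k t)⁻¹).1 = (Real.cos t : ℂ) • 1 - (Complex.I * Real.sin t) • pauli k := by
  rw [su2_coe_inv, expPauli_coe, conjTranspose_add, conjTranspose_smul, conjTranspose_smul,
    pauli_conjTranspose, conjTranspose_one, sub_eq_add_neg, ← neg_smul]
  simp only [star_mul', Complex.star_def, Complex.conj_ofReal, Complex.conj_I, neg_mul]

theorem expPauli_zero (k : Fin 3) : expPauli k 0 = 1 := by
  apply Subtype.ext
  simp [expPauli_coe]

theorem hasDerivAt_cos_zero : HasDerivAt (fun t : ℝ => (Real.cos t : ℂ)) 0 0 := by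
  simpa using (Real.hasDerivAt_cos 0).ofReal_comp

theorem hasDerivAt_sin_zero : HasDerivAt (fun t : ℝ => (Real.sin t : ℂ)) 1 0 := by
  simpa using (Real.hasDerivAt_sin 0).ofReal_comp

theorem hasDerivAt_rotMatrix_expPauli (k m j : Fin 3) :
    HasDerivAt (fun t => rotMatrix (expPauli k t) m j) (-2 * eps k j m) 0 := by
  set A := (pauli m * pauli j).trace
  set B := (pauli m * (pauli k * pauli j)).trace
  set C := (pauli m * (pauli j * pauli k)).trace
  set E := (pauli m * (pauli k * pauli j * pauli k)).trace
  have hBC : B - C = 4 * Complex.I * eps k j m := by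
    have := congrArg (fun M => (pauli m * M).trace) (pauli_commutator k j)
    simp only [pauli_coeff, mul_sub, trace_sub] at this
    linear_combination this
  have hf : (fun t => rotMatrix (expPauli k t) m j) = fun t : ℝ => (1 / 2 : ℂ) *
      ((Real.cos t : ℂ) * Real.cos t * A + Complex.I * (Real.sin t * Real.cos t) * (B - C)
        + Real.sin t * Real.sin t * E) := by
    funext t
    simp only [rotMatrix, Matrix.of_apply, expPauli_coe, expPauli_inv_coe, mul_add, add_mul,
      mul_sub, smul_mul_assoc, mul_smul_comm, one_mul, mul_one, trace_add, trace_sub, trace_smul,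
      smul_eq_mul, A, B, C, E]
    linear_combination (-(1 / 2) : ℂ) * Real.sin t * Real.sin t * E * Complex.I_sq
  rw [hf]
  have hc := hasDerivAt_cos_zero
  have hs := hasDerivAt_sin_zero
  refine (((((hc.mul hc).mul_const A).add
    (((hs.mul hc).const_mul Complex.I).mul_const (B - C))).add
    ((hs.mul hs).mul_const E)).const_mul (1 / 2 : ℂ)).congr_deriv ?_
  rw [hBC]
  simp
  linear_combination (2 : ℂ) * eps k j m * Complex.I_sq

variable {lam : ℝ}

theorem alg_induction {P : Alg lam → Prop} (hx : ∀ i, P (x lam i))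
    (hc : ∀ c, P (algebraMap ℂ _ c)) (hadd : ∀ a b, P a → P b → P (a + b))
    (hmul : ∀ a b, P a → P b → P (a * b)) (a : Alg lam) : P a := by
  obtain ⟨b, rfl⟩ := RingQuot.mkAlgHom_surjective ℂ (Rel lam) a
  induction b using FreeAlgebra.induction with
  | grade0 c => simpa using hc c
  | grade1 i => exact hx i
  | add a b ha hb => simpa using hadd _ _ ha hb
  | mul a b ha hb => simpa using hmul _ _ ha hb

/-- The one-parameter subgroup `exp(i t σ_k)` acts on the fuzzy sphere with velocity
`-2 ∂_k = 2 i L_k`. Both sides obey the Leibniz rule, so only the generators have to be checked. -/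
theorem hasVelocity_rot (hlam : lam ≠ 0) (k : Fin 3) (a : Alg lam) :
    HasVelocity (fun t => rot lam (expPauli k t) a) ((-2 : ℂ) • partialD lam k a) := by
  induction a using alg_induction with
  | hx j =>
    simp only [rot_x]
    have hd := congrFun (d_x lam hlam j) k
    simp only [d, LinearMap.pi_apply] at hd
    rw [hd, Finset.smul_sum]
    refine HasVelocity.sum _ fun m _ => ?_
    rw [smul_smul]
    refine HasVelocity.smul_const ((hasDerivAt_rotMatrix_expPauli k m j).congr_deriv ?_) _
    simp only [eps]
    ring
  | hc c =>
    have : (-2 : ℂ) • partialD lam k (algebraMap ℂ _ c) = 0 := by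
      simp [partialD_apply, Algebra.commutes]
    simp only [AlgHom.commutes, this]
    exact HasVelocity.const _
  | hadd a b ha hb =>
    simp only [map_add, smul_add]
    exact ha.add hb
  | hmul a b ha hb =>
    simp only [map_mul]
    have h := ha.mul hb
    rw [expPauli_zero, rot_one] at h
    convert h using 1
    have hd := congrFun (d_mul lam a b) k
    simp only [d, LinearMap.pi_apply, Pi.add_apply] at hd
    rw [hd, smul_add, smul_mul_assoc, mul_smul_comm]
    rfl

theorem spinorRep_apply (g : SU2) (ψ : Spinor lam) (α : Fin 2) :
    spinorRep lam g ψ α = ∑ β, (g⁻¹).1 β α • rot lam g (ψ β) := rfl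

/-- The one-parameter subgroup `exp(i t σ_k)` acts on spinors with velocity `2 i J_k`. -/
theorem hasVelocity_spinorRep (hlam : lam ≠ 0) (k : Fin 3) (ψ : Spinor lam) :
    HasVelocity (fun t => spinorRep lam (expPauli k t) ψ)
      (fun α => (-2 : ℂ) • partialD lam k (ψ α) - ∑ β, (Complex.I * pauli k β α) • ψ β) := by
  have hα : ∀ α, HasVelocity (fun t => spinorRep lam (expPauli k t) ψ α)
      ((-2 : ℂ) • partialD lam k (ψ α) - ∑ β, (Complex.I * pauli k β α) • ψ β) := by
    intro α
    have hβ : ∀ β, HasVelocity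
        (fun t => ((expPauli k t)⁻¹).1 β α • rot lam (expPauli k t) (ψ β))
        ((-(Complex.I * pauli k β α)) • ψ β +
          (1 : Matrix (Fin 2) (Fin 2) ℂ) β α • (-2 : ℂ) • partialD lam k (ψ β)) := by
      intro β
      have hf : HasDerivAt (fun t => ((expPauli k t)⁻¹).1 β α) (-(Complex.I * pauli k β α)) 0 := by
        simp only [expPauli_inv_coe, Matrix.sub_apply, Matrix.smul_apply, smul_eq_mul]
        refine ((hasDerivAt_cos_zero.mul_const _).sub
          ((hasDerivAt_sin_zero.const_mul Complex.I).mul_const _)).congr_deriv ?_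
        simp
      have h := (hasVelocity_rot hlam k (ψ β)).smul hf
      rw [expPauli_zero, rot_one, inv_one] at h
      exact h
    have h := HasVelocity.sum Finset.univ fun β _ => hβ β
    refine (congrArg _ ?_).mp h
    rw [Finset.sum_add_distrib]
    simp only [Matrix.one_apply, ite_smul, one_smul, zero_smul, Finset.sum_ite_eq', Finset.mem_univ,
      if_true, Fin.sum_univ_two]
    module
  have h := HasVelocity.sum Finset.univ fun α _ =>
    (hα α).map (LinearMap.single ℂ (fun _ : Fin 2 => Alg lam) α)
  simpa only [LinearMap.coe_single, Finset.univ_sum_single] using h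

/-- An `SU(2)`-stable subspace of `𝒮` is stable under the total angular momentum. -/
theorem total_mem_of_stable (hlam : lam ≠ 0) {W : Submodule ℂ (Spinor lam)}
    (hW : ∀ g, ∀ ψ ∈ W, spinorRep lam g ψ ∈ W) {ψ : Spinor lam} (hψ : ψ ∈ W) :
    J3 lam ψ ∈ W ∧ Jp lam ψ ∈ W ∧ Jm lam ψ ∈ W := by
  have h := fun k => (hasVelocity_spinorRep hlam k ψ).mem (W := W) fun t => hW _ _ hψ
  have h0 := h 0
  have h1 := h 1
  have h2 := h 2
  obtain ⟨a0, a1, a2⟩ := partialD_eq (ψ 0)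
  obtain ⟨b0, b1, b2⟩ := partialD_eq (ψ 1)
  refine ⟨?_, ?_, ?_⟩
  · convert W.smul_mem (-(Complex.I / 2)) h2 using 1
    funext α
    fin_cases α <;> simp [J3_apply, pauli, a2, b2] <;> match_scalars <;> ring_nf <;>
      simp <;> norm_num
  · convert W.add_mem (W.smul_mem (-(Complex.I / 2)) h0) (W.smul_mem (1 / 2 : ℂ) h1) using 1
    funext α
    fin_cases α <;> simp [Jp_apply, pauli, a0, b0, a1, b1] <;> match_scalars <;> ring_nf <;>
      simp <;> norm_num
  · convert W.sub_mem (W.smul_mem (-(Complex.I / 2)) h0) (W.smul_mem (1 / 2 : ℂ) h1) using 1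
    funext α
    fin_cases α <;> simp [Jm_apply, pauli, a0, b0, a1, b1] <;> match_scalars <;> ring_nf <;>
      simp <;> norm_num

/-- A rotation-stable subspace of the fuzzy sphere is stable under the orbital angular momentum. -/
theorem orbital_mem_of_stable (hlam : lam ≠ 0) {W : Submodule ℂ (Alg lam)}
    (hW : ∀ g, ∀ a ∈ W, rot lam g a ∈ W) {a : Alg lam} (ha : a ∈ W) :
    L3 lam a ∈ W ∧ Lp lam a ∈ W ∧ Lm lam a ∈ W := by
  have h := fun k => (hasVelocity_rot hlam k a).mem (W := W) fun t => hW _ _ ha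
  have h0 := h 0
  have h1 := h 1
  have h2 := h 2
  obtain ⟨a0, a1, a2⟩ := partialD_eq a
  rw [a0] at h0
  rw [a1] at h1
  rw [a2] at h2
  refine ⟨?_, ?_, ?_⟩
  · convert W.smul_mem (-(Complex.I / 2)) h2 using 1
    match_scalars
    ring_nf
    simp
  · convert W.add_mem (W.smul_mem (-(Complex.I / 2)) h0) (W.smul_mem (1 / 2 : ℂ) h1) using 1
    match_scalars <;> ring_nf <;> norm_num
  · convert W.sub_mem (W.smul_mem (-(Complex.I / 2)) h0) (W.smul_mem (1 / 2 : ℂ) h1) using 1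
    match_scalars <;> ring_nf <;> norm_num

theorem x_eq_sum_rot (g : SU2) (i : Fin 3) :
    x lam i = ∑ j, rotMatrix g i j • rot lam g (x lam j) := by
  simp only [rot_x, Finset.smul_sum, smul_smul]
  rw [Finset.sum_comm]
  have hR : ∀ k, ∑ j, rotMatrix g i j * rotMatrix g k j = if i = k then 1 else 0 := by
    intro k
    have := congrFun (congrFun (rotMatrix_mul_transpose g) i) k
    simpa [Matrix.mul_apply, Matrix.one_apply] using this
  simp only [← Finset.sum_smul, hR]
  simp

theorem partialD_rot (g : SU2) (i : Fin 3) (a : Alg lam) :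
    partialD lam i (rot lam g a) = ∑ j, rotMatrix g i j • rot lam g (partialD lam j a) := by
  simp only [partialD_apply, map_smul, map_sub, map_mul, smul_comm _ (2 * Complex.I * (lam : ℂ))⁻¹]
  rw [← Finset.smul_sum]
  congr 1
  conv_lhs => rw [x_eq_sum_rot g i]
  simp only [Finset.sum_mul, Finset.mul_sum, ← Finset.sum_sub_distrib, smul_mul_assoc,
    mul_smul_comm, smul_sub]

/-- The Dirac operator is rotation invariant. -/
theorem iDirac_spinorRep (g : SU2) (ψ : Spinor lam) :
    iDirac lam (spinorRep lam g ψ) = spinorRep lam g (iDirac lam ψ) := by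
  have hd : dirac lam (spinorRep lam g ψ) = spinorRep lam g (dirac lam ψ) := by
    funext α
    -- the entries of `g⁻¹ (∑ i, R(g)_{ij} σ^i) = σ^j g⁻¹`
    have key : ∀ j γ, ∑ i, ∑ β, (pauli i β α * (g⁻¹).1 γ β * rotMatrix g i j) =
        ∑ β, pauli j γ β * (g⁻¹).1 β α := by
      intro j γ
      have h1 : (g⁻¹).1 * (∑ i, rotMatrix g i j • pauli i) = pauli j * (g⁻¹).1 := by
        rw [← conj_pauli, ← Matrix.mul_assoc, ← Matrix.mul_assoc, su2_inv_mul, Matrix.one_mul]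
      have h2 := congrFun (congrFun h1 γ) α
      rw [Matrix.mul_apply, Matrix.mul_apply] at h2
      rw [← h2, Finset.sum_comm]
      refine Finset.sum_congr rfl fun β _ => ?_
      simp only [Matrix.sum_apply, Matrix.smul_apply, smul_eq_mul, Finset.mul_sum]
      exact Finset.sum_congr rfl fun i _ => by ring
    rw [dirac_apply, spinorRep_apply]
    simp only [spinorRep_apply, dirac_apply, map_add, map_sum, map_smul, smul_add,
      Finset.sum_add_distrib, partialD_rot, Finset.smul_sum, smul_smul]
    congr 1
    · trans ∑ j, ∑ γ, (∑ β, pauli j γ β * (g⁻¹).1 β α) • rot lam g (partialD lam j (ψ γ))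
      · simp only [← key, Finset.sum_smul, mul_assoc]
        exact (Finset.sum_congr rfl fun i _ => (Finset.sum_congr rfl fun β _ =>
          Finset.sum_comm).trans Finset.sum_comm).trans (Finset.sum_comm.trans
            (Finset.sum_congr rfl fun j _ => (Finset.sum_congr rfl fun i _ =>
              Finset.sum_comm).trans Finset.sum_comm))
      · simp only [Finset.sum_smul, mul_comm (pauli _ _ _)]
        exact ((Finset.sum_congr rfl fun β _ => Finset.sum_comm).trans
          (Finset.sum_comm.trans (Finset.sum_congr rfl fun γ _ => Finset.sum_comm)) |>.trans
            Finset.sum_comm).symm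
    · exact Finset.sum_congr rfl fun β _ => by rw [mul_comm]
  simp only [iDirac, LinearMap.smul_apply, hd, map_smul]

end Rotation

/-! ### An infinite dimensional representation of the fuzzy sphere -/

section Representation

/-- The weighted shifts `φ ↦ (n ↦ φ (n - 1))`, `φ ↦ (n ↦ (c - n² - n) φ (n + 1))` and
`φ ↦ (n ↦ n φ n)` represent `K₊`, `K₋`, `K₃` on functions on `ℤ`, where `c` is the Casimir value;
these are the images of the generators `x_i`. -/
def shiftGen (lam : ℝ) : Fin 3 → Module.End ℂ (ℤ → ℂ)
  | 0 =>
    { toFun := fun φ n => lam * (φ (n - 1) + (casimir lam - n ^ 2 - n) * φ (n + 1))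
      map_add' := fun φ ψ => by funext n; simp; ring
      map_smul' := fun c φ => by funext n; simp; ring }
  | 1 =>
    { toFun := fun φ n =>
        -(Complex.I * lam) * (φ (n - 1) - (casimir lam - n ^ 2 - n) * φ (n + 1))
      map_add' := fun φ ψ => by funext n; simp; ring
      map_smul' := fun c φ => by funext n; simp; ring }
  | 2 =>
    { toFun := fun φ n => 2 * lam * n * φ n
      map_add' := fun φ ψ => by funext n; simp; ring
      map_smul' := fun c φ => by funext n; simp; ring }

theorem shiftGen_comm (lam : ℝ) (i j : Fin 3) :
    shiftGen lam i * shiftGen lam j - shiftGen lam j * shiftGen lam i =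
      ∑ k, (2 * Complex.I * (lam : ℂ) * eps i j k) • shiftGen lam k := by
  have hI := Complex.I_sq
  refine LinearMap.ext fun φ => funext fun n => ?_
  simp only [LinearMap.sub_apply, Module.End.mul_apply, Fin.sum_univ_three, Pi.sub_apply]
  fin_cases i <;> fin_cases j <;> simp [shiftGen, eps] <;> grind

theorem shiftGen_radius {lam : ℝ} (hlam : lam ≠ 0) :
    ∑ i, shiftGen lam i * shiftGen lam i =
      algebraMap ℂ (Module.End ℂ (ℤ → ℂ)) (1 - (lam : ℂ) ^ 2) := by
  have h : (lam : ℂ) ≠ 0 := by exact_mod_cast hlam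
  have hc : 4 * (lam : ℂ) ^ 2 * casimir lam = 1 - (lam : ℂ) ^ 2 := by
    rw [casimir]; field_simp; ring
  have hI := Complex.I_sq
  refine LinearMap.ext fun φ => funext fun n => ?_
  rw [← hc]
  simp only [Fin.sum_univ_three, Module.algebraMap_end_apply, Pi.smul_apply, smul_eq_mul]
  simp [shiftGen]
  grind

/-- The representation of the fuzzy sphere on functions on `ℤ` by weighted shifts. -/
def shiftRep {lam : ℝ} (hlam : lam ≠ 0) : Alg lam →ₐ[ℂ] Module.End ℂ (ℤ → ℂ) :=
  RingQuot.liftAlgHom ℂ ⟨FreeAlgebra.lift ℂ (shiftGen lam), by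
    rintro _ _ (⟨i, j⟩ | _)
    · simpa only [map_sub, map_mul, map_sum, map_smul, FreeAlgebra.lift_ι_apply] using
        shiftGen_comm lam i j
    · simpa only [map_mul, map_sum, FreeAlgebra.lift_ι_apply, AlgHom.commutes] using
        shiftGen_radius hlam⟩

theorem shiftRep_x {lam : ℝ} (hlam : lam ≠ 0) (j : Fin 3) :
    shiftRep hlam (x lam j) = shiftGen lam j := by
  simp only [shiftRep, x, RingQuot.liftAlgHom_mkAlgHom_apply, FreeAlgebra.lift_ι_apply]

/-- In the representation by weighted shifts `K₊` fixes the constant functions. -/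
theorem Kp_pow_ne_zero {lam : ℝ} (hlam : lam ≠ 0) (l : ℕ) : Kp lam ^ l ≠ 0 := by
  have h : (lam : ℂ) ≠ 0 := by exact_mod_cast hlam
  have h1 : shiftRep hlam (Kp lam) (fun _ => 1) = fun _ => 1 := by
    funext n
    simp only [Kp, map_smul, map_add, shiftRep_x, LinearMap.smul_apply, LinearMap.add_apply,
      Pi.smul_apply, Pi.add_apply, smul_eq_mul]
    simp [shiftGen]
    field_simp
    linear_combination (-1 + (casimir lam - n ^ 2 - n)) * Complex.I_sq
  have h2 : ((shiftRep hlam (Kp lam)) ^ l) (fun _ => 1) = fun _ => 1 := by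
    induction l with
    | zero => simp
    | succ l ih => rw [pow_succ, Module.End.mul_apply, h1, ih]
  intro h0
  rw [← map_pow, h0, map_zero] at h2
  simpa using congrFun h2 0

end Representation

/-! ### Noncommutative spherical harmonics -/

section Harmonics

theorem tensorEval_prod (lam : ℝ) (n : Fin 3 → ℂ) (l : ℕ) :
    tensorEval lam l (fun i => ∏ p, n (i p)) = (∑ k, n k • x lam k) ^ l := by
  induction l with
  | zero => simp [tensorEval, Fintype.linearCombination_apply]
  | succ l ih =>
    rw [pow_succ', ← ih]
    simp only [tensorEval, Fintype.linearCombination_apply]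
    rw [← (Fin.consEquiv fun _ => Fin 3).sum_comp, Fintype.sum_prod_type, Finset.sum_mul_sum]
    refine Finset.sum_congr rfl fun k _ => Finset.sum_congr rfl fun i _ => ?_
    simp [Fin.consEquiv, Fin.prod_univ_succ, smul_smul, mul_comm]

theorem prod_mem_symTraceFree {n : Fin 3 → ℂ} (hn : ∑ k, n k * n k = 0) (l : ℕ) :
    (fun i : Fin l → Fin 3 => ∏ p, n (i p)) ∈ symTraceFree l := by
  refine ⟨fun π i => ?_, fun p q hpq i => ?_⟩
  · exact Equiv.prod_comp π fun p => n (i p)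
  · have h : ∀ k, ∏ r, n (Function.update (Function.update i p k) q k r) =
        n k * n k * ∏ r ∈ (Finset.univ.erase q).erase p, n (i r) := by
      intro k
      rw [← Finset.mul_prod_erase Finset.univ _ (Finset.mem_univ q),
        ← Finset.mul_prod_erase (Finset.univ.erase q) _ (Finset.mem_erase.mpr ⟨hpq, by simp⟩)]
      simp only [Function.update_self, Function.update_of_ne hpq, mul_assoc]
      congr 2
      refine Finset.prod_congr rfl fun r hr => ?_
      simp only [Finset.mem_erase] at hr
      rw [Function.update_of_ne hr.2.1, Function.update_of_ne hr.1]
    simp only [h, ← Finset.sum_mul, hn, zero_mul]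

/-- The multi-index `0 ⋯ 0 1 ⋯ 1 2 ⋯ 2` with `1` starting in position `a` and `2` in position
`b`. -/
def sortedIndex (l a b : ℕ) : Fin l → Fin 3 :=
  fun p => if (p : ℕ) < a then 0 else if (p : ℕ) < b then 1 else 2

theorem exists_threshold {l : ℕ} (P : Fin l → Prop) (hP : ∀ p q, p ≤ q → P q → P p) :
    ∃ a ≤ l, ∀ p : Fin l, P p ↔ (p : ℕ) < a := by
  classical
  have hex : ∃ a, ∀ p : Fin l, a ≤ (p : ℕ) → ¬ P p := ⟨l, fun p hp => absurd p.2 (by omega)⟩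
  refine ⟨Nat.find hex, Nat.find_min' hex fun p hp => absurd p.2 (by omega), fun p => ?_⟩
  constructor
  · intro hp
    by_contra hlt
    exact Nat.find_spec hex p (by omega) hp
  · intro hlt
    have := Nat.find_min hex hlt
    push Not at this
    obtain ⟨q, hpq, hq⟩ := this
    exact hP p q hpq hq

theorem exists_perm_sortedIndex {l : ℕ} (i : Fin l → Fin 3) :
    ∃ (π : Equiv.Perm (Fin l)) (a b : ℕ), a ≤ b ∧ b ≤ l ∧ i ∘ π = sortedIndex l a b := by
  have hmono : Monotone (i ∘ Tuple.sort i) := Tuple.monotone_sort i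
  obtain ⟨a, hal, ha⟩ := exists_threshold (fun p => (i ∘ Tuple.sort i) p = 0)
    fun p q hpq (hq : _ = _) => le_antisymm (hq ▸ hmono hpq) (Fin.zero_le _)
  obtain ⟨b, hbl, hb⟩ := exists_threshold (fun p => (i ∘ Tuple.sort i) p ≤ 1)
    fun p q hpq hq => (hmono hpq).trans hq
  refine ⟨Tuple.sort i, min a b, b, min_le_right _ _, hbl, funext fun p => ?_⟩
  have h0 := ha p
  have h1 := hb p
  have hab : (p : ℕ) < a → (p : ℕ) < b := fun h => h1.mp ((h0.mpr h).trans_le (by decide))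
  generalize (i ∘ Tuple.sort i) p = j at *
  simp only [sortedIndex, lt_min_iff]
  by_cases hpa : (p : ℕ) < a
  · simp [hpa, hab hpa, h0.mpr hpa]
  · by_cases hpb : (p : ℕ) < b
    · have hj0 := mt h0.mp hpa
      have hj1 := h1.mpr hpb
      simp only [hpa, false_and, if_false, hpb, if_true]
      omega
    · have hj1 := mt h1.mp hpb
      simp only [hpa, false_and, if_false, hpb]
      omega

/-- A symmetric trace free tensor is determined by its components with at most one index `2`: a pair
of indices `2` can be traded for a pair `0` and a pair `1`. -/
theorem symTraceFree_eq_zero {l : ℕ} {f : (Fin l → Fin 3) → ℂ} (hf : f ∈ symTraceFree l)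
    (h0 : ∀ a ≤ l, f (sortedIndex l a l) = 0) (h1 : ∀ a < l, f (sortedIndex l a (l - 1)) = 0) :
    f = 0 := by
  suffices H : ∀ N, ∀ i : Fin l → Fin 3, (Finset.univ.filter fun p => i p = 2).card = N → f i = 0 by
    funext i
    exact H _ i rfl
  intro N
  induction N using Nat.strong_induction_on with
  | _ N ih =>
    intro i hi
    by_cases hpq : ∃ p q, p ≠ q ∧ i p = 2 ∧ i q = 2
    · obtain ⟨p, q, hne, hp, hq⟩ := hpq
      have htr := hf.2 p q hne i
      rw [Fin.sum_univ_three] at htr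
      have h2 : Function.update (Function.update i p 2) q 2 = i := by
        rw [← hp, Function.update_eq_self, hp, ← hq, Function.update_eq_self]
      have hlt : ∀ k : Fin 3, k ≠ 2 → f (Function.update (Function.update i p k) q k) = 0 := by
        intro k hk
        refine ih _ ?_ _ rfl
        rw [← hi]
        refine Finset.card_lt_card
          ((Finset.ssubset_iff_of_subset ?_).mpr ⟨p, by simpa using hp, ?_⟩)
        · intro r hr
          simp only [Finset.mem_filter, Finset.mem_univ, true_and, Function.update_apply] at hr ⊢
          split_ifs at hr with h3 h4
          · exact absurd hr hk
          · exact absurd hr hk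
          · exact hr
        · simp [Function.update_of_ne hne, hk]
      rw [h2, hlt 0 (by decide), hlt 1 (by decide), zero_add, zero_add] at htr
      exact htr
    · obtain ⟨π, a, b, hab, hbl, hπ⟩ := exists_perm_sortedIndex i
      rw [← hf.1 π, hπ]
      have hb : l ≤ b + 1 := by
        by_contra hlt
        refine hpq ⟨π ⟨b, by omega⟩, π ⟨b + 1, by omega⟩, ?_, ?_, ?_⟩
        · simp
        · have := congrFun hπ ⟨b, by omega⟩
          simpa [sortedIndex, hab.not_gt] using this
        · have := congrFun hπ ⟨b + 1, by omega⟩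
          simpa [sortedIndex, (hab.trans (Nat.le_succ b)).not_gt] using this
      rcases (by omega : b = l ∨ b = l - 1 ∧ a < l ∨ b = l - 1 ∧ a = l) with
        rfl | ⟨rfl, ha⟩ | ⟨rfl, ha⟩
      · exact h0 a hab
      · exact h1 a ha
      · have : l = 0 := by omega
        subst this
        exact h0 a hab

/-- The components that determine a symmetric trace free tensor number `l + 1` without an index `2`
and `l` with exactly one. -/
theorem finrank_symTraceFree_le (l : ℕ) : Module.finrank ℂ (symTraceFree l) ≤ 2 * l + 1 := by
  let F : ((Fin l → Fin 3) → ℂ) →ₗ[ℂ] (Fin (l + 1) ⊕ Fin l → ℂ) :=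
    LinearMap.funLeft ℂ ℂ
      (Sum.elim (fun a : Fin (l + 1) => sortedIndex l a l) fun a : Fin l => sortedIndex l a (l - 1))
  have hinj : Function.Injective (F ∘ₗ (symTraceFree l).subtype) := by
    rw [← LinearMap.ker_eq_bot, LinearMap.ker_eq_bot']
    rintro ⟨f, hf⟩ h
    apply Subtype.ext
    refine symTraceFree_eq_zero hf (fun a ha => ?_) fun a ha => ?_
    · exact congrFun h (Sum.inl ⟨a, by omega⟩)
    · exact congrFun h (Sum.inr ⟨a, ha⟩)
  refine (LinearMap.finrank_le_finrank_of_injective hinj).trans ?_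
  simp
  omega

variable {lam : ℝ}

instance (l : ℕ) : FiniteDimensional ℂ (harmonics lam l) :=
  inferInstanceAs (FiniteDimensional ℂ ((symTraceFree l).map (tensorEval lam l)))

theorem finrank_harmonics_le (l : ℕ) : Module.finrank ℂ (harmonics lam l) ≤ 2 * l + 1 :=
  (Submodule.finrank_map_le _ _).trans (finrank_symTraceFree_le l)

variable (lam) in
/-- The span of the powers `(n_i x_i)^l` with `n` a null vector. -/
def nullSpan (l : ℕ) : Submodule ℂ (Alg lam) :=
  Submodule.span ℂ {a | ∃ n : Fin 3 → ℂ, ∑ k, n k * n k = 0 ∧ a = (∑ k, n k • x lam k) ^ l}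

theorem nullSpan_le_harmonics (l : ℕ) : nullSpan lam l ≤ harmonics lam l := by
  rw [nullSpan, Submodule.span_le]
  rintro _ ⟨n, hn, rfl⟩
  exact ⟨_, prod_mem_symTraceFree hn l, tensorEval_prod lam n l⟩

theorem rot_mem_nullSpan (l : ℕ) (g : SU2) {a : Alg lam} (ha : a ∈ nullSpan lam l) :
    rot lam g a ∈ nullSpan lam l := by
  suffices h : nullSpan lam l ≤ (nullSpan lam l).comap (rot lam g).toLinearMap from h ha
  conv_lhs => rw [nullSpan]
  rw [Submodule.span_le]
  rintro _ ⟨n, hn, rfl⟩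
  refine Submodule.subset_span ⟨rotMatrix g *ᵥ n, ?_, ?_⟩
  · change (rotMatrix g *ᵥ n) ⬝ᵥ (rotMatrix g *ᵥ n) = 0
    rw [Matrix.dotProduct_mulVec, Matrix.vecMul_mulVec, rotMatrix_transpose_mul,
      Matrix.vecMul_one]
    exact hn
  · simp only [AlgHom.toLinearMap_apply, map_pow, map_sum, map_smul, rot_x, Finset.smul_sum,
      smul_smul, Matrix.mulVec, dotProduct, Finset.sum_smul]
    rw [Finset.sum_comm]
    simp only [mul_comm]

theorem Kp_pow_mem_nullSpan (l : ℕ) : Kp lam ^ l ∈ nullSpan lam l := by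
  refine Submodule.subset_span
    ⟨![(2 * (lam : ℂ))⁻¹, (2 * (lam : ℂ))⁻¹ * Complex.I, 0], ?_, ?_⟩
  · simp [Fin.sum_univ_three]
    linear_combination ((2 * (lam : ℂ))⁻¹) ^ 2 * Complex.I_sq
  · simp [Fin.sum_univ_three, Kp, smul_add, smul_smul]

theorem L3_Kp_pow (hlam : lam ≠ 0) (l : ℕ) : L3 lam (Kp lam ^ l) = (l : ℂ) • Kp lam ^ l := by
  induction l with
  | zero => simp [L3_apply]
  | succ l ih =>
    rw [L3_apply, sub_eq_iff_eq_add] at ih ⊢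
    rw [pow_succ, ← mul_assoc, ih, add_mul, mul_assoc _ (K3 lam), K3_mul_Kp hlam]
    push_cast
    rw [add_smul, one_smul, mul_add, smul_mul_assoc, mul_assoc]
    abel

theorem Lp_Kp_pow (l : ℕ) : Lp lam (Kp lam ^ l) = 0 := by
  rw [Lp_apply, ← pow_succ, ← pow_succ', sub_self]

/-- `A_l` is spanned by the vectors `L₋^k K₊^l`, `k ≤ 2 l`: these are independent, they lie in the
rotation-stable span of powers of null combinations, and `A_l` has dimension at most `2 l + 1`. -/
theorem span_pow_eq_harmonics (hlam : lam ≠ 0) (l : ℕ) :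
    Submodule.span ℂ (Set.range fun k : Fin (2 * l + 1) => (Lm lam ^ (k : ℕ)) (Kp lam ^ l)) =
      harmonics lam l ∧ nullSpan lam l = harmonics lam l ∧
        Module.finrank ℂ (harmonics lam l) = 2 * l + 1 := by
  have hli := (isLadder_orbital hlam).linearIndependent_pow (Kp_pow_ne_zero hlam l)
    (L3_Kp_pow hlam l) (Lp_Kp_pow l) (2 * l) (by
      intro k hk h
      have : 2 * l = k := by exact_mod_cast h
      omega)
  have hmem : ∀ k : ℕ, (Lm lam ^ k) (Kp lam ^ l) ∈ nullSpan lam l := by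
    intro k
    induction k with
    | zero => simpa using Kp_pow_mem_nullSpan l
    | succ k ih =>
      rw [pow_succ', Module.End.mul_apply]
      exact (orbital_mem_of_stable hlam (fun g a ha => rot_mem_nullSpan l g ha) ih).2.2
  have hle : Submodule.span ℂ (Set.range fun k : Fin (2 * l + 1) =>
      (Lm lam ^ (k : ℕ)) (Kp lam ^ l)) ≤ nullSpan lam l := by
    rw [Submodule.span_le]
    rintro _ ⟨k, rfl⟩
    exact hmem k
  have hrank := finrank_span_eq_card hli
  rw [Fintype.card_fin] at hrank
  have heq := Submodule.eq_of_le_of_finrank_le (hle.trans (nullSpan_le_harmonics l))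
    (by rw [hrank]; exact finrank_harmonics_le l)
  refine ⟨heq, le_antisymm (nullSpan_le_harmonics l) (heq ▸ hle), ?_⟩
  rw [← heq, hrank]

theorem finrank_harmonics (hlam : lam ≠ 0) (l : ℕ) :
    Module.finrank ℂ (harmonics lam l) = 2 * l + 1 :=
  (span_pow_eq_harmonics hlam l).2.2

theorem orbital_mem_harmonics (hlam : lam ≠ 0) {l : ℕ} {a : Alg lam} (ha : a ∈ harmonics lam l) :
    L3 lam a ∈ harmonics lam l ∧ Lp lam a ∈ harmonics lam l ∧ Lm lam a ∈ harmonics lam l := by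
  rw [← (span_pow_eq_harmonics hlam l).2.1] at ha ⊢
  exact orbital_mem_of_stable hlam (fun g a ha => rot_mem_nullSpan l g ha) ha

theorem Lsq_Lm (hlam : lam ≠ 0) (a : Alg lam) : Lsq lam (Lm lam a) = Lm lam (Lsq lam a) := by
  have h := isLadder_orbital hlam
  simp only [Lsq_apply, h.comm, h.lower, map_add, map_sub, map_smul]
  module

theorem Lsq_of_mem_harmonics (hlam : lam ≠ 0) {l : ℕ} {a : Alg lam} (ha : a ∈ harmonics lam l) :
    Lsq lam a = ((l : ℂ) * (l + 1)) • a := by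
  suffices h : harmonics lam l ≤ (Lsq lam).eigenspace ((l : ℂ) * (l + 1)) from
    Module.End.mem_eigenspace_iff.mp (h ha)
  rw [← (span_pow_eq_harmonics hlam l).1, Submodule.span_le]
  rintro _ ⟨k, rfl⟩
  rw [SetLike.mem_coe, Module.End.mem_eigenspace_iff]
  dsimp only
  generalize (k : ℕ) = m
  induction m with
  | zero =>
    simp only [pow_zero, Module.End.one_apply, Lsq_apply, Lp_Kp_pow, L3_Kp_pow hlam, map_zero,
      map_smul]
    module
  | succ m ih =>
    rw [pow_succ', Module.End.mul_apply, Lsq_Lm hlam, ih, map_smul]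

end Harmonics

/-! ### The fuzzy sphere is spanned by the harmonics -/

section Filtration

variable (lam : ℝ)

/-- The filtration by degree: the span of the monomials `K₃^k K₊^m` and `K₃^k K₋^m` with
`k + m ≤ N`. -/
def filtration (N : ℕ) : Submodule ℂ (Alg lam) :=
  Submodule.span ℂ {a | ∃ k m, k + m ≤ N ∧
    (a = K3 lam ^ k * Kp lam ^ m ∨ a = K3 lam ^ k * Km lam ^ m)}

variable {lam}

theorem K3_pow_mul_Kp_pow_mem {k m N : ℕ} (h : k + m ≤ N) :
    K3 lam ^ k * Kp lam ^ m ∈ filtration lam N :=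
  Submodule.subset_span ⟨k, m, h, Or.inl rfl⟩

theorem K3_pow_mul_Km_pow_mem {k m N : ℕ} (h : k + m ≤ N) :
    K3 lam ^ k * Km lam ^ m ∈ filtration lam N :=
  Submodule.subset_span ⟨k, m, h, Or.inr rfl⟩

theorem filtration_mono {M N : ℕ} (h : M ≤ N) : filtration lam M ≤ filtration lam N :=
  Submodule.span_mono fun _ ⟨k, m, hkm, ha⟩ => ⟨k, m, hkm.trans h, ha⟩

theorem mul_mem_of_generators {u : Alg lam} {N : ℕ}
    (hp : ∀ k m, k + m ≤ N → u * (K3 lam ^ k * Kp lam ^ m) ∈ filtration lam (N + 1))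
    (hm : ∀ k m, k + m ≤ N → u * (K3 lam ^ k * Km lam ^ m) ∈ filtration lam (N + 1))
    {a : Alg lam} (ha : a ∈ filtration lam N) : u * a ∈ filtration lam (N + 1) := by
  suffices h : filtration lam N ≤ (filtration lam (N + 1)).comap (LinearMap.mulLeft ℂ u) from h ha
  conv_lhs => rw [filtration]
  rw [Submodule.span_le]
  rintro _ ⟨k, m, hkm, rfl | rfl⟩
  · exact hp k m hkm
  · exact hm k m hkm

theorem K3_mul_mem {N : ℕ} {a : Alg lam} (ha : a ∈ filtration lam N) :
    K3 lam * a ∈ filtration lam (N + 1) := by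
  refine mul_mem_of_generators (fun k m h => ?_) (fun k m h => ?_) ha
  · rw [← mul_assoc, ← pow_succ']
    exact K3_pow_mul_Kp_pow_mem (by omega)
  · rw [← mul_assoc, ← pow_succ']
    exact K3_pow_mul_Km_pow_mem (by omega)

/-- If left multiplication by `u` shifts the weight by `c`, in the sense that
`u K₃ = (K₃ - c) u`, then it may be moved past powers of `K₃`. -/
theorem mul_K3_pow_mul_mem {u w : Alg lam} {c : ℂ} (hu : u * K3 lam = K3 lam * u - c • u) {N : ℕ}
    (hw : u * w ∈ filtration lam (N + 1)) (k : ℕ) :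
    u * (K3 lam ^ k * w) ∈ filtration lam (N + k + 1) := by
  induction k with
  | zero => simpa using hw
  | succ k ih =>
    rw [pow_succ', mul_assoc, ← mul_assoc u, hu, sub_mul, mul_assoc, smul_mul_assoc]
    exact Submodule.sub_mem _ (K3_mul_mem ih)
      (Submodule.smul_mem _ _ (filtration_mono (by omega) ih))

/-- The products `u = K₊ K₋` and `u = K₋ K₊` are quadratic polynomials in `K₃`, which raise the
degree by at most `2`. -/
theorem casimir_mul_mem {u : Alg lam} {s : ℂ}
    (hu : u = algebraMap ℂ _ (casimir lam) - K3 lam * K3 lam + s • K3 lam) {N : ℕ} {a : Alg lam}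
    (ha : a ∈ filtration lam N) : u * a ∈ filtration lam (N + 2) := by
  have h1 := K3_mul_mem ha
  rw [hu, add_mul, sub_mul, ← Algebra.smul_def, mul_assoc, smul_mul_assoc]
  exact Submodule.add_mem _ (Submodule.sub_mem _
    (Submodule.smul_mem _ _ (filtration_mono (by omega) ha)) (K3_mul_mem h1))
    (Submodule.smul_mem _ _ (filtration_mono (by omega) h1))

theorem Kp_mul_mem (hlam : lam ≠ 0) {N : ℕ} {a : Alg lam} (ha : a ∈ filtration lam N) :
    Kp lam * a ∈ filtration lam (N + 1) := by
  have hu : Kp lam * K3 lam = K3 lam * Kp lam - (1 : ℂ) • Kp lam := by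
    rw [one_smul, K3_mul_Kp hlam, add_sub_cancel_right]
  refine mul_mem_of_generators (fun k m h => ?_) (fun k m h => ?_) ha
  · refine filtration_mono (by omega : m + k + 1 ≤ N + 1) (mul_K3_pow_mul_mem hu ?_ k)
    rw [← pow_succ']
    simpa using K3_pow_mul_Kp_pow_mem (lam := lam) (k := 0) (m := m + 1) (by omega)
  · refine filtration_mono (by omega : m + k + 1 ≤ N + 1) (mul_K3_pow_mul_mem hu ?_ k)
    cases m with
    | zero => simpa using K3_pow_mul_Kp_pow_mem (lam := lam) (k := 0) (m := 1) (by omega)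
    | succ m =>
      rw [pow_succ', ← mul_assoc]
      refine casimir_mul_mem (s := 1) (by rw [one_smul, Kp_mul_Km hlam]) ?_
      simpa using K3_pow_mul_Km_pow_mem (lam := lam) (k := 0) (m := m) (by omega)

theorem Km_mul_mem (hlam : lam ≠ 0) {N : ℕ} {a : Alg lam} (ha : a ∈ filtration lam N) :
    Km lam * a ∈ filtration lam (N + 1) := by
  have hu : Km lam * K3 lam = K3 lam * Km lam - (-1 : ℂ) • Km lam := by
    rw [K3_mul_Km hlam]
    module
  refine mul_mem_of_generators (fun k m h => ?_) (fun k m h => ?_) ha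
  · refine filtration_mono (by omega : m + k + 1 ≤ N + 1) (mul_K3_pow_mul_mem hu ?_ k)
    cases m with
    | zero => simpa using K3_pow_mul_Km_pow_mem (lam := lam) (k := 0) (m := 1) (by omega)
    | succ m =>
      rw [pow_succ', ← mul_assoc]
      refine casimir_mul_mem (s := -1) (by rw [Km_mul_Kp hlam]; module) ?_
      simpa using K3_pow_mul_Kp_pow_mem (lam := lam) (k := 0) (m := m) (by omega)
  · refine filtration_mono (by omega : m + k + 1 ≤ N + 1) (mul_K3_pow_mul_mem hu ?_ k)
    rw [← pow_succ']
    simpa using K3_pow_mul_Km_pow_mem (lam := lam) (k := 0) (m := m + 1) (by omega)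

theorem x_mul_mem (hlam : lam ≠ 0) (i : Fin 3) {N : ℕ} {a : Alg lam} (ha : a ∈ filtration lam N) :
    x lam i * a ∈ filtration lam (N + 1) := by
  obtain ⟨h0, h1, h2⟩ := x_eq hlam
  have hp := Kp_mul_mem hlam ha
  have hm := Km_mul_mem hlam ha
  fin_cases i
  · change x lam 0 * a ∈ _
    rw [h0, smul_mul_assoc, add_mul]
    exact Submodule.smul_mem _ _ (Submodule.add_mem _ hp hm)
  · change x lam 1 * a ∈ _
    rw [h1, smul_mul_assoc, sub_mul]
    exact Submodule.smul_mem _ _ (Submodule.sub_mem _ hp hm)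
  · change x lam 2 * a ∈ _
    rw [h2, smul_mul_assoc]
    exact Submodule.smul_mem _ _ (K3_mul_mem ha)

theorem one_mem_filtration (N : ℕ) : (1 : Alg lam) ∈ filtration lam N := by
  simpa using K3_pow_mul_Kp_pow_mem (lam := lam) (k := 0) (m := 0) (Nat.zero_le N)

theorem harmonics_le_filtration (hlam : lam ≠ 0) (l : ℕ) :
    harmonics lam l ≤ filtration lam l := by
  rw [← (span_pow_eq_harmonics hlam l).2.1, nullSpan, Submodule.span_le]
  rintro _ ⟨n, -, rfl⟩
  rw [SetLike.mem_coe]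
  induction l with
  | zero => simpa using one_mem_filtration 0
  | succ l ih =>
    rw [pow_succ', Finset.sum_mul]
    refine Submodule.sum_mem _ fun k _ => ?_
    rw [smul_mul_assoc]
    exact Submodule.smul_mem _ _ (x_mul_mem hlam k ih)

theorem exists_mem_filtration (hlam : lam ≠ 0) (a : Alg lam) : ∃ N, a ∈ filtration lam N := by
  suffices h : ∀ M, ∀ b ∈ filtration lam M, ∃ N, a * b ∈ filtration lam N by
    simpa using h 0 1 (one_mem_filtration 0)
  induction a using alg_induction with
  | hx i => exact fun M b hb => ⟨M + 1, x_mul_mem hlam i hb⟩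
  | hc c =>
    intro M b hb
    rw [← Algebra.smul_def]
    exact ⟨M, Submodule.smul_mem _ _ hb⟩
  | hadd a₁ a₂ h₁ h₂ =>
    intro M b hb
    obtain ⟨N₁, h₁⟩ := h₁ M b hb
    obtain ⟨N₂, h₂⟩ := h₂ M b hb
    rw [add_mul]
    exact ⟨max N₁ N₂, Submodule.add_mem _ (filtration_mono (le_max_left _ _) h₁)
      (filtration_mono (le_max_right _ _) h₂)⟩
  | hmul a₁ a₂ h₁ h₂ =>
    intro M b hb
    obtain ⟨N₂, h₂⟩ := h₂ M b hb
    rw [mul_assoc]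
    exact h₁ N₂ _ h₂

/-- The monomials `K₃^k K₊^m`, `K₃^k K₋^m` with `k + m ≤ N` are indexed by the pairs `(p, q)` with
`p, q ≤ N`: take `k = min p q` and `m = |p - q|`, with the sign of `p - q` choosing `K₊` or
`K₋`. -/
theorem filtration_eq_span_range (N : ℕ) :
    filtration lam N = Submodule.span ℂ (Set.range fun p : Fin (N + 1) × Fin (N + 1) =>
      K3 lam ^ min (p.1 : ℕ) p.2 * (Kp lam ^ ((p.1 : ℕ) - p.2) * Km lam ^ ((p.2 : ℕ) - p.1))) := by
  rw [filtration]
  congr 1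
  ext a
  constructor
  · rintro ⟨k, m, h, rfl | rfl⟩
    · exact ⟨(⟨k + m, by omega⟩, ⟨k, by omega⟩), by simp⟩
    · exact ⟨(⟨k, by omega⟩, ⟨k + m, by omega⟩), by simp⟩
  · rintro ⟨⟨p, q⟩, rfl⟩
    rcases le_total (p : ℕ) q with h | h
    · exact ⟨p, q - p, by omega, Or.inr (by simp [h])⟩
    · exact ⟨q, p - q, by omega, Or.inl (by simp [h])⟩

instance (N : ℕ) : FiniteDimensional ℂ (filtration lam N) := by
  rw [filtration_eq_span_range]
  exact FiniteDimensional.span_of_finite ℂ (Set.finite_range _)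

theorem finrank_filtration_le (N : ℕ) :
    Module.finrank ℂ (filtration lam N) ≤ (N + 1) * (N + 1) := by
  rw [filtration_eq_span_range]
  exact (finrank_range_le_card _).trans (by simp)

theorem harmonics_le_eigenspace (hlam : lam ≠ 0) (l : ℕ) :
    harmonics lam l ≤ (Lsq lam).eigenspace ((l : ℂ) * (l + 1)) := fun _ ha =>
  Module.End.mem_eigenspace_iff.mpr (Lsq_of_mem_harmonics hlam ha)

/-- The harmonics of different degrees are eigenvectors of `L²` for different eigenvalues. -/
theorem disjoint_harmonics (hlam : lam ≠ 0) (N : ℕ) :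
    Disjoint (⨆ l < N, harmonics lam l) (harmonics lam N) := by
  have hind := (Module.End.eigenspaces_iSupIndep (Lsq lam)) ((N : ℂ) * (N + 1))
  refine (hind.mono_right (iSup₂_le fun l hl => ?_)).symm.mono_right
    (harmonics_le_eigenspace hlam N)
  refine (harmonics_le_eigenspace hlam l).trans (le_iSup₂_of_le _ ?_ le_rfl)
  intro h
  have : l * (l + 1) = N * (N + 1) := by exact_mod_cast h
  nlinarith

theorem iSup_harmonics_le_filtration (hlam : lam ≠ 0) (N : ℕ) :
    ⨆ l < N + 1, harmonics lam l ≤ filtration lam N :=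
  iSup₂_le fun _ hl => (harmonics_le_filtration hlam _).trans
    (filtration_mono (Nat.lt_succ_iff.mp hl))

theorem mul_self_le_finrank_iSup_harmonics (hlam : lam ≠ 0) (N : ℕ) :
    N * N ≤ Module.finrank ℂ (⨆ l < N, harmonics lam l : Submodule ℂ (Alg lam)) := by
  induction N with
  | zero => exact Nat.zero_le _
  | succ N ih =>
    have hfd : FiniteDimensional ℂ (⨆ l < N, harmonics lam l : Submodule ℂ (Alg lam)) :=
      Submodule.finiteDimensional_of_le ((biSup_mono fun _ hl => Nat.lt_succ_of_lt hl).trans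
        (iSup_harmonics_le_filtration hlam N))
    have hs := Submodule.finrank_sup_add_finrank_inf_eq (⨆ l < N, harmonics lam l)
      (harmonics lam N)
    rw [(disjoint_harmonics hlam N).eq_bot, finrank_bot, finrank_harmonics hlam,
      ← Nat.iSup_lt_succ] at hs
    linarith

/-- A dimension count: the harmonics of degree at most `N` already have dimension
`1 + 3 + ⋯ + (2 N + 1) = (N + 1)²`. -/
theorem iSup_harmonics_eq_filtration (hlam : lam ≠ 0) (N : ℕ) :
    ⨆ l < N + 1, harmonics lam l = filtration lam N :=
  Submodule.eq_of_le_of_finrank_le (iSup_harmonics_le_filtration hlam N)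
    ((finrank_filtration_le N).trans (mul_self_le_finrank_iSup_harmonics hlam (N + 1)))

theorem iSup_harmonics (hlam : lam ≠ 0) : ⨆ l, harmonics lam l = ⊤ := by
  rw [eq_top_iff]
  intro a _
  obtain ⟨N, ha⟩ := exists_mem_filtration hlam a
  rw [← iSup_harmonics_eq_filtration hlam N] at ha
  exact iSup₂_le (fun l _ => le_iSup (harmonics lam) l) ha

end Filtration

/-! ### The spectrum of the Dirac operator -/

section Eigenspaces

variable {K V ι : Type*} [Field K] [AddCommGroup V] [Module K V] {f : Module.End K V}
  {μ : ι → K} {G : ι → Submodule K V}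

theorem eigenspace_disjoint_iSup {ν : K} {s : Set ι} (hs : ∀ i ∈ s, μ i ≠ ν)
    (hG : ∀ i, G i ≤ f.eigenspace (μ i)) : Disjoint (f.eigenspace ν) (⨆ i ∈ s, G i) :=
  (f.eigenspaces_iSupIndep ν).mono_right <|
    iSup₂_le fun i hi => (hG i).trans (le_iSup₂_of_le (μ i) (hs i hi) le_rfl)

theorem eigenspace_eq_bot_of_iSup_eq_top (hG : ∀ i, G i ≤ f.eigenspace (μ i))
    (htop : ⨆ i, G i = ⊤) {ν : K} (hν : ∀ i, μ i ≠ ν) : f.eigenspace ν = ⊥ := by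
  have h := eigenspace_disjoint_iSup (s := Set.univ) (fun i _ => hν i) hG
  simpa [htop] using h

/-- If subspaces of eigenspaces for distinct values span, they are the whole eigenspaces. -/
theorem eigenspace_eq_of_iSup_eq_top (hμ : Function.Injective μ)
    (hG : ∀ i, G i ≤ f.eigenspace (μ i)) (htop : ⨆ i, G i = ⊤) (i : ι) :
    f.eigenspace (μ i) = G i := by
  refine le_antisymm (fun v hv => ?_) (hG i)
  have h := eigenspace_disjoint_iSup (s := {i}ᶜ) (fun j hj => hμ.ne hj) hG
  have hsup : G i ⊔ ⨆ j ∈ ({i}ᶜ : Set ι), G j = ⊤ := by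
    rw [← htop]
    exact (iSup_split_single G i).symm
  obtain ⟨w, hw, r, hr, hwr⟩ := Submodule.mem_sup.mp (hsup ▸ Submodule.mem_top : v ∈ _)
  have hr' : r ∈ f.eigenspace (μ i) := by
    rw [← hwr] at hv
    exact (Submodule.add_mem_iff_right _ (hG i hw)).mp hv
  rw [Submodule.disjoint_def.mp h r hr' hr, add_zero] at hwr
  exact hwr ▸ hw

theorem isInternal_eigenspace_of_iSup_eq_top [DecidableEq K]
    (hG : ∀ i, G i ≤ f.eigenspace (μ i)) (htop : ⨆ i, G i = ⊤) :
    DirectSum.IsInternal fun ν : K => f.eigenspace ν :=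
  DirectSum.isInternal_submodule_of_iSupIndep_of_iSup_eq_top f.eigenspaces_iSupIndep <|
    eq_top_iff.mpr (htop ▸ iSup_le fun i => (hG i).trans (le_iSup f.eigenspace (μ i)))

end Eigenspaces

section Spectrum

variable {lam : ℝ}

/-- The eigenvalue `λ_{l,s} + 3/4` of the spin-orbit operator. -/
def spinOrbitValue (l : ℕ) (s : ℤˣ) : ℂ := eigenvalue l s + 3 / 4

theorem spinOrbitValue_one (l : ℕ) : spinOrbitValue l 1 = l + 1 := by
  simp [spinOrbitValue, eigenvalue]; ring

theorem spinOrbitValue_neg_one (l : ℕ) : spinOrbitValue l (-1) = -l := by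
  simp [spinOrbitValue, eigenvalue]; ring

theorem mem_eigenspace_iDirac_iff {l : ℕ} {s : ℤˣ} {ψ : Spinor lam} :
    ψ ∈ (iDirac lam).eigenspace (eigenvalue l s) ↔ spinOrbit lam ψ = spinOrbitValue l s • ψ := by
  rw [Module.End.mem_eigenspace_iff, spinOrbit, spinOrbitValue, add_smul, LinearMap.add_apply,
    LinearMap.smul_apply, Module.End.one_apply, add_left_inj]

theorem eigenvalue_injective : Function.Injective fun p : ℕ × ℤˣ => eigenvalue p.1 p.2 := by
  rintro ⟨l, s⟩ ⟨l', s'⟩ h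
  have h' : spinOrbitValue l s = spinOrbitValue l' s' := congrArg (· + 3 / 4) h
  have hcast : ∀ m n : ℕ, ((m : ℂ) + 1 ≠ -n) := by
    intro m n hmn
    have : ((m + 1 + n : ℕ) : ℂ) = 0 := by push_cast; rw [hmn]; ring
    exact absurd (Nat.cast_eq_zero.mp this) (by omega)
  rcases Int.units_eq_one_or s with rfl | rfl <;> rcases Int.units_eq_one_or s' with rfl | rfl <;>
    simp only [spinOrbitValue_one, spinOrbitValue_neg_one] at h'
  · rw [Nat.cast_injective (add_right_cancel h')]
  · exact absurd h' (hcast _ _)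
  · exact absurd h'.symm (hcast _ _)
  · rw [Nat.cast_injective (neg_injective h')]

theorem mem_spinorL {l : ℕ} {ψ : Spinor lam} :
    ψ ∈ spinorL lam l ↔ ψ 0 ∈ harmonics lam l ∧ ψ 1 ∈ harmonics lam l := by
  simp [spinorL, Submodule.mem_pi, Fin.forall_fin_two]

theorem spinorL_eq_sup (l : ℕ) :
    spinorL lam l = (harmonics lam l).map (LinearMap.single ℂ (fun _ : Fin 2 => Alg lam) 0) ⊔
      (harmonics lam l).map (LinearMap.single ℂ (fun _ : Fin 2 => Alg lam) 1) := by
  apply le_antisymm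
  · intro ψ hψ
    rw [mem_spinorL] at hψ
    have : ψ = LinearMap.single ℂ (fun _ : Fin 2 => Alg lam) 0 (ψ 0) +
        LinearMap.single ℂ (fun _ : Fin 2 => Alg lam) 1 (ψ 1) := by
      funext α; fin_cases α <;> simp
    rw [this]
    exact Submodule.add_mem_sup (Submodule.mem_map_of_mem hψ.1) (Submodule.mem_map_of_mem hψ.2)
  · refine sup_le ?_ ?_ <;> rw [Submodule.map_le_iff_le_comap] <;> intro a ha <;>
      simp [mem_spinorL, ha]

instance (l : ℕ) : FiniteDimensional ℂ (spinorL lam l) := by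
  rw [spinorL_eq_sup]
  infer_instance

theorem finrank_spinorL_le (l : ℕ) : Module.finrank ℂ (spinorL lam l) ≤ 2 * (2 * l + 1) := by
  rw [spinorL_eq_sup]
  refine (Submodule.finrank_add_le_finrank_add_finrank _ _).trans ?_
  have h0 := (Submodule.finrank_map_le (LinearMap.single ℂ (fun _ : Fin 2 => Alg lam) 0)
    (harmonics lam l)).trans (finrank_harmonics_le l)
  have h1 := (Submodule.finrank_map_le (LinearMap.single ℂ (fun _ : Fin 2 => Alg lam) 1)
    (harmonics lam l)).trans (finrank_harmonics_le l)
  exact (Nat.add_le_add h0 h1).trans (by omega)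

theorem iSup_spinorL (hlam : lam ≠ 0) : ⨆ l, spinorL lam l = ⊤ := by
  simp only [spinorL_eq_sup]
  rw [iSup_sup_eq, ← Submodule.map_iSup, ← Submodule.map_iSup, iSup_harmonics hlam, eq_top_iff]
  intro ψ _
  have : ψ = LinearMap.single ℂ (fun _ : Fin 2 => Alg lam) 0 (ψ 0) +
      LinearMap.single ℂ (fun _ : Fin 2 => Alg lam) 1 (ψ 1) := by
    funext α; fin_cases α <;> simp
  rw [this]
  exact Submodule.add_mem_sup (Submodule.mem_map_of_mem trivial) (Submodule.mem_map_of_mem trivial)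

theorem spinOrbit_mem_spinorL (hlam : lam ≠ 0) {l : ℕ} {ψ : Spinor lam}
    (hψ : ψ ∈ spinorL lam l) : spinOrbit lam ψ ∈ spinorL lam l := by
  rw [mem_spinorL] at hψ ⊢
  obtain ⟨a3, -, am⟩ := orbital_mem_harmonics hlam hψ.1
  obtain ⟨b3, bp, -⟩ := orbital_mem_harmonics hlam hψ.2
  simp only [spinOrbit_apply, cons_val_zero, cons_val_one]
  exact ⟨Submodule.add_mem _ a3 bp, Submodule.sub_mem _ am b3⟩

theorem total_mem_spinorL (hlam : lam ≠ 0) {l : ℕ} {ψ : Spinor lam} (hψ : ψ ∈ spinorL lam l) :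
    J3 lam ψ ∈ spinorL lam l ∧ Jp lam ψ ∈ spinorL lam l ∧ Jm lam ψ ∈ spinorL lam l := by
  rw [mem_spinorL] at hψ
  obtain ⟨a3, ap, am⟩ := orbital_mem_harmonics hlam hψ.1
  obtain ⟨b3, bp, bm⟩ := orbital_mem_harmonics hlam hψ.2
  simp only [mem_spinorL, J3_apply, Jp_apply, Jm_apply, cons_val_zero, cons_val_one]
  exact ⟨⟨Submodule.sub_mem _ a3 (Submodule.smul_mem _ _ hψ.1),
      Submodule.add_mem _ b3 (Submodule.smul_mem _ _ hψ.2)⟩,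
    ⟨ap, Submodule.sub_mem _ bp hψ.1⟩, ⟨Submodule.sub_mem _ am hψ.2, bm⟩⟩

/-- `(T + l) (T - l - 1) = 0` on `𝒮_l`. -/
theorem spinOrbit_sq_of_mem (hlam : lam ≠ 0) {l : ℕ} {ψ : Spinor lam} (hψ : ψ ∈ spinorL lam l) :
    spinOrbit lam (spinOrbit lam ψ) = spinOrbit lam ψ + ((l : ℂ) * (l + 1)) • ψ := by
  rw [spinOrbit_spinOrbit hlam, add_comm]
  congr 1
  rw [mem_spinorL] at hψ
  funext α
  fin_cases α
  · exact Lsq_of_mem_harmonics hlam hψ.1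
  · exact Lsq_of_mem_harmonics hlam hψ.2

variable (lam) in
/-- The eigenvectors of `i D` for the eigenvalue `λ_{l,s}` that lie in `𝒮_l`. -/
def spinEigen (l : ℕ) (s : ℤˣ) : Submodule ℂ (Spinor lam) :=
  (iDirac lam).eigenspace (eigenvalue l s) ⊓ spinorL lam l

instance (l : ℕ) (s : ℤˣ) : FiniteDimensional ℂ (spinEigen lam l s) :=
  Submodule.finiteDimensional_inf_right _ _

theorem spinEigen_sup (hlam : lam ≠ 0) (l : ℕ) :
    spinEigen lam l (-1) ⊔ spinEigen lam l 1 = spinorL lam l := by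
  refine le_antisymm (sup_le inf_le_right inf_le_right) fun ψ hψ => ?_
  have hT := spinOrbit_mem_spinorL hlam hψ
  have hTT := spinOrbit_sq_of_mem hlam hψ
  have h0 : (2 * (l : ℂ) + 1) ≠ 0 := by exact_mod_cast Nat.succ_ne_zero (2 * l)
  -- the two spectral projections of `T` on `𝒮_l`
  have hψ' : ψ = (-(2 * (l : ℂ) + 1)⁻¹) • (spinOrbit lam ψ - ((l : ℂ) + 1) • ψ) +
      (2 * (l : ℂ) + 1)⁻¹ • (spinOrbit lam ψ + (l : ℂ) • ψ) := by
    match_scalars <;> field_simp <;> ring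
  rw [hψ']
  refine Submodule.add_mem_sup (Submodule.smul_mem _ _ ⟨?_, ?_⟩)
    (Submodule.smul_mem _ _ ⟨?_, ?_⟩)
  · rw [SetLike.mem_coe, mem_eigenspace_iDirac_iff, spinOrbitValue_neg_one, map_sub, map_smul, hTT]
    module
  · exact Submodule.sub_mem _ hT (Submodule.smul_mem _ _ hψ)
  · rw [SetLike.mem_coe, mem_eigenspace_iDirac_iff, spinOrbitValue_one, map_add, map_smul, hTT]
    module
  · exact Submodule.add_mem _ hT (Submodule.smul_mem _ _ hψ)

theorem iSup_spinEigen (hlam : lam ≠ 0) : ⨆ p : ℕ × ℤˣ, spinEigen lam p.1 p.2 = ⊤ := by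
  rw [eq_top_iff, ← iSup_spinorL hlam]
  refine iSup_le fun l => ?_
  rw [← spinEigen_sup hlam]
  exact sup_le (le_iSup (fun p : ℕ × ℤˣ => spinEigen lam p.1 p.2) (l, -1))
    (le_iSup (fun p : ℕ × ℤˣ => spinEigen lam p.1 p.2) (l, 1))

theorem eigenspace_eq_spinEigen (hlam : lam ≠ 0) (l : ℕ) (s : ℤˣ) :
    (iDirac lam).eigenspace (eigenvalue l s) = spinEigen lam l s :=
  eigenspace_eq_of_iSup_eq_top eigenvalue_injective (fun _ => inf_le_left) (iSup_spinEigen hlam)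
    (l, s)

/-- On `𝒮_l` the operator `T` is not a nonzero scalar, since on the two components of a spinor it
acts with diagonal entries `L₃` and `-L₃`. -/
theorem spinOrbit_scalar_eq_zero (hlam : lam ≠ 0) {l : ℕ} {μ : ℂ}
    (h : ∀ ψ ∈ spinorL lam l, spinOrbit lam ψ = μ • ψ) : μ = 0 := by
  have ha : Kp lam ^ l ∈ harmonics lam l := nullSpan_le_harmonics l (Kp_pow_mem_nullSpan l)
  have h0 := congrFun (h ![Kp lam ^ l, 0] (by simp [mem_spinorL, ha])) 0
  have h1 := congrFun (h ![0, Kp lam ^ l] (by simp [mem_spinorL, ha])) 1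
  have h0' : L3 lam (Kp lam ^ l) = μ • Kp lam ^ l := by simpa [spinOrbit_apply] using h0
  have h1' : -L3 lam (Kp lam ^ l) = μ • Kp lam ^ l := by simpa [spinOrbit_apply] using h1
  have h2 : ((2 : ℂ) * μ) • Kp lam ^ l = 0 := by
    rw [mul_smul, two_smul]
    nth_rw 1 [← h1']
    rw [← h0', neg_add_cancel]
  simpa [Kp_pow_ne_zero hlam] using h2

theorem spinEigen_neg_one_ne_bot (hlam : lam ≠ 0) (l : ℕ) : spinEigen lam l (-1) ≠ ⊥ := by
  intro hbot
  have hsup := spinEigen_sup hlam l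
  rw [hbot, bot_sup_eq] at hsup
  have h := spinOrbit_scalar_eq_zero hlam (l := l) (μ := l + 1) fun ψ hψ => by
    rw [← hsup] at hψ
    rw [mem_eigenspace_iDirac_iff.mp hψ.1, spinOrbitValue_one]
  exact Nat.cast_add_one_ne_zero l h

theorem spinEigen_one_ne_bot (hlam : lam ≠ 0) {l : ℕ} (hl : 1 ≤ l) : spinEigen lam l 1 ≠ ⊥ := by
  intro hbot
  have hsup := spinEigen_sup hlam l
  rw [hbot, sup_bot_eq] at hsup
  have h := spinOrbit_scalar_eq_zero hlam (l := l) (μ := -l) fun ψ hψ => by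
    rw [← hsup] at hψ
    rw [mem_eigenspace_iDirac_iff.mp hψ.1, spinOrbitValue_neg_one]
  rw [neg_eq_zero, Nat.cast_eq_zero] at h
  omega

theorem spinorRep_mem_eigenspace {μ : ℂ} (g : SU2) {ψ : Spinor lam}
    (hψ : ψ ∈ (iDirac lam).eigenspace μ) : spinorRep lam g ψ ∈ (iDirac lam).eigenspace μ := by
  rw [Module.End.mem_eigenspace_iff] at hψ ⊢
  rw [iDirac_spinorRep, hψ, map_smul]

/-- `λ_{l,-}` and `λ_{l,+}` belong to total spin `l + 1/2` and `l - 1/2`: a nonzero subspace of the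
eigenspace that is stable under the total angular momentum has at least the dimension of that
spin. -/
theorem le_finrank_of_le_spinEigen (hlam : lam ≠ 0) {l n : ℕ} {s : ℤˣ}
    (hn : (n : ℤ) + s = 2 * l) {W : Submodule ℂ (Spinor lam)} (hW : W ≠ ⊥)
    (hle : W ≤ spinEigen lam l s)
    (hJ : ∀ ψ ∈ W, J3 lam ψ ∈ W ∧ Jp lam ψ ∈ W ∧ Jm lam ψ ∈ W) :
    n + 1 ≤ Module.finrank ℂ W := by
  have : FiniteDimensional ℂ W := Submodule.finiteDimensional_of_le hle
  refine (isLadder_total hlam).le_finrank hW (fun ψ hψ => (hJ ψ hψ).1)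
    (fun ψ hψ => (hJ ψ hψ).2.1) (fun ψ hψ => (hJ ψ hψ).2.2) n fun ψ hψ => ?_
  have hT := mem_eigenspace_iDirac_iff.mp (hle hψ).1
  have hnC : (n : ℂ) + ((s : ℤ) : ℂ) = 2 * l := by exact_mod_cast hn
  rw [total_casimir hlam, hT, map_smul, hT]
  rcases Int.units_eq_one_or s with rfl | rfl
  · rw [spinOrbitValue_one]
    have : (n : ℂ) = 2 * l - 1 := by simpa using eq_sub_of_add_eq hnC
    rw [this]
    module
  · rw [spinOrbitValue_neg_one]
    have : (n : ℂ) = 2 * l + 1 := by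
      simp at hnC
      linear_combination hnC
    rw [this]
    module

theorem disjoint_eigenspace_iDirac (l : ℕ) :
    Disjoint ((iDirac lam).eigenspace (eigenvalue l (-1)))
      ((iDirac lam).eigenspace (eigenvalue l 1)) :=
  (iDirac lam).eigenspaces_iSupIndep.pairwiseDisjoint
    (eigenvalue_injective.ne (a₁ := (l, -1)) (a₂ := (l, 1)) (by simp))

/-- The two parts of `𝒮_l` have dimension at least `2 l + 2` and `2 l` by their total spin, and
together at most `4 l + 2`. -/
theorem finrank_spinEigen (hlam : lam ≠ 0) (l : ℕ) :
    Module.finrank ℂ (spinEigen lam l (-1)) = 2 * l + 2 ∧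
      Module.finrank ℂ (spinEigen lam l 1) = 2 * l := by
  have hJ : ∀ s, ∀ ψ ∈ spinEigen lam l s, J3 lam ψ ∈ spinEigen lam l s ∧
      Jp lam ψ ∈ spinEigen lam l s ∧ Jm lam ψ ∈ spinEigen lam l s := by
    intro s ψ hψ
    obtain ⟨e3, ep, em⟩ := total_mem_of_stable hlam
      (fun g ψ hψ => spinorRep_mem_eigenspace g hψ) hψ.1
    obtain ⟨l3, lp, lm⟩ := total_mem_spinorL hlam hψ.2
    exact ⟨⟨e3, l3⟩, ⟨ep, lp⟩, ⟨em, lm⟩⟩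
  have h1 : 2 * l + 1 + 1 ≤ Module.finrank ℂ (spinEigen lam l (-1)) :=
    le_finrank_of_le_spinEigen hlam (s := -1) (by push_cast; ring)
      (spinEigen_neg_one_ne_bot hlam l) le_rfl (hJ _)
  have h2 : 2 * l ≤ Module.finrank ℂ (spinEigen lam l 1) := by
    rcases Nat.eq_zero_or_pos l with rfl | hl
    · simp
    · have := le_finrank_of_le_spinEigen hlam (l := l) (n := 2 * l - 1) (s := 1)
        (by push_cast; omega) (spinEigen_one_ne_bot hlam hl) le_rfl (hJ _)
      omega
  have hdisj : Disjoint (spinEigen lam l (-1)) (spinEigen lam l 1) :=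
    (disjoint_eigenspace_iDirac l).mono inf_le_left inf_le_left
  have hs := Submodule.finrank_sup_add_finrank_inf_eq (spinEigen lam l (-1)) (spinEigen lam l 1)
  rw [hdisj.eq_bot, finrank_bot, spinEigen_sup hlam] at hs
  have := finrank_spinorL_le (lam := lam) l
  omega

theorem finrank_spinEigen_eq_multiplicity (hlam : lam ≠ 0) (l : ℕ) (s : ℤˣ) :
    (Module.finrank ℂ (spinEigen lam l s) : ℤ) = FuzzySphere.multiplicity l s := by
  obtain ⟨h1, h2⟩ := finrank_spinEigen hlam l
  rcases Int.units_eq_one_or s with rfl | rfl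
  · rw [h2, FuzzySphere.multiplicity]; push_cast; ring
  · rw [h1, FuzzySphere.multiplicity]; push_cast; ring

/-- An eigenspace is irreducible because every nonzero stable subspace has its dimension. -/
theorem isTotalSpinIrreducible_eigenspace (hlam : lam ≠ 0) {l n : ℕ} {s : ℤˣ}
    (hn : (n : ℤ) + s = 2 * l)
    (hrank : Module.finrank ℂ (spinEigen lam l s) = n + 1) {j : ℚ} (hj : 2 * j = n) :
    IsTotalSpinIrreducible lam ((iDirac lam).eigenspace (eigenvalue l s)) j := by
  have heq := eigenspace_eq_spinEigen hlam l s
  let σ : Subrepresentation (spinorRep lam) :=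
    ⟨(iDirac lam).eigenspace (eigenvalue l s), fun g _ hψ => spinorRep_mem_eigenspace g hψ⟩
  refine ⟨σ, rfl, ?_, ?_⟩
  · have hfd : FiniteDimensional ℂ σ.toSubmodule := by
      change FiniteDimensional ℂ ((iDirac lam).eigenspace (eigenvalue l s))
      rw [heq]
      infer_instance
    have hσ : Module.finrank ℂ σ.toSubmodule = n + 1 := by rw [← hrank, ← heq]
    have hnt : Nontrivial σ.toSubmodule := Module.nontrivial_of_finrank_pos (R := ℂ) (by omega)
    have hnt' : Nontrivial (Subrepresentation σ.toRepresentation) :=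
      ⟨⊥, ⊤, fun h => bot_ne_top (α := Submodule ℂ σ.toSubmodule)
        (congrArg Subrepresentation.toSubmodule h)⟩
    refine ⟨fun τ => ?_⟩
    set W := τ.toSubmodule.map σ.toSubmodule.subtype with hWdef
    rcases eq_or_ne W ⊥ with hW | hW
    · left
      apply Subrepresentation.toSubmodule_injective
      exact Submodule.map_injective_of_injective σ.toSubmodule.subtype_injective
        (hW.trans (Submodule.map_bot _).symm)
    · right
      apply Subrepresentation.toSubmodule_injective
      have hstable : ∀ g, ∀ ψ ∈ W, spinorRep lam g ψ ∈ W := by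
        rintro g _ ⟨v, hv, rfl⟩
        exact ⟨σ.toRepresentation g v, τ.apply_mem_toSubmodule g hv, rfl⟩
      have hle := le_finrank_of_le_spinEigen hlam hn hW
        ((Submodule.map_subtype_le _ _).trans heq.le)
        fun ψ hψ => total_mem_of_stable hlam hstable hψ
      have : Module.finrank ℂ W = Module.finrank ℂ τ.toSubmodule :=
        Submodule.finrank_map_subtype_eq _ _
      have hle' : Module.finrank ℂ σ.toSubmodule ≤ Module.finrank ℂ τ.toSubmodule := by
        rw [hσ, ← this]
        exact hle
      exact Submodule.eq_top_of_finrank_eq (K := ℂ) (V := σ.toSubmodule) (S := τ.toSubmodule)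
        (le_antisymm (Submodule.finrank_le _) hle')
  · rw [heq, hrank, hj]
    push_cast
    rfl

end Spectrum

end FuzzySphere

end

theorem mainTheorem4 (lam : ℝ) (hlam : lam ≠ 0) :
    -- `iD` is diagonalisable: the spinors are the direct sum of its eigenspaces
    DirectSum.IsInternal (fun μ : ℂ => (FuzzySphere.iDirac lam).eigenspace μ) ∧
    -- the eigenvalues are the `λ_{l,±}`, where `l = 0` gives only `λ_{0,-}`
    (∀ μ : ℂ, (FuzzySphere.iDirac lam).HasEigenvalue μ ↔
      ∃ (l : ℕ) (s : ℤˣ), (l, s) ≠ (0, 1) ∧ μ = FuzzySphere.eigenvalue l s) ∧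
    -- the multiplicities are `n_{l,±}`, and the eigenvectors have orbital angular momentum `l`
    (∀ (l : ℕ) (s : ℤˣ),
      FiniteDimensional ℂ ((FuzzySphere.iDirac lam).eigenspace (FuzzySphere.eigenvalue l s)) ∧
      (Module.finrank ℂ
        ((FuzzySphere.iDirac lam).eigenspace (FuzzySphere.eigenvalue l s)) : ℤ) =
          FuzzySphere.multiplicity l s ∧
      (FuzzySphere.iDirac lam).eigenspace (FuzzySphere.eigenvalue l s) ≤
        FuzzySphere.spinorL lam l) ∧
    -- `𝒮_l` is the direct sum of the two eigenspaces for `λ_{l,±}`, which are irreducibles of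
    -- total spin `l + 1/2` (for `λ_{l,-}`) and, when `l ≥ 1`, `l - 1/2` (for `λ_{l,+}`)
    (∀ l : ℕ,
      (FuzzySphere.iDirac lam).eigenspace (FuzzySphere.eigenvalue l (-1)) ⊔
        (FuzzySphere.iDirac lam).eigenspace (FuzzySphere.eigenvalue l 1) =
          FuzzySphere.spinorL lam l ∧
      Disjoint ((FuzzySphere.iDirac lam).eigenspace (FuzzySphere.eigenvalue l (-1)))
        ((FuzzySphere.iDirac lam).eigenspace (FuzzySphere.eigenvalue l 1)) ∧
      FuzzySphere.IsTotalSpinIrreducible lam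
        ((FuzzySphere.iDirac lam).eigenspace (FuzzySphere.eigenvalue l (-1)))
        ((l : ℚ) + 1 / 2) ∧
      (1 ≤ l → FuzzySphere.IsTotalSpinIrreducible lam
        ((FuzzySphere.iDirac lam).eigenspace (FuzzySphere.eigenvalue l 1))
        ((l : ℚ) - 1 / 2))) := by
  refine ⟨?_, fun μ => ⟨fun hμ => ?_, ?_⟩, fun l s => ?_, fun l => ⟨?_, ?_, ?_, fun hl => ?_⟩⟩
  · exact FuzzySphere.isInternal_eigenspace_of_iSup_eq_top (fun _ => inf_le_left)
      (FuzzySphere.iSup_spinEigen hlam)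
  · rw [Module.End.hasEigenvalue_iff] at hμ
    by_contra hne
    apply hμ
    by_cases h : ∃ p : ℕ × ℤˣ, FuzzySphere.eigenvalue p.1 p.2 = μ
    · obtain ⟨⟨l, s⟩, rfl⟩ := h
      have hls : (l, s) = (0, 1) := by
        by_contra hls
        exact hne ⟨l, s, hls, rfl⟩
      obtain ⟨rfl, rfl⟩ := Prod.mk.inj hls
      rw [FuzzySphere.eigenspace_eq_spinEigen hlam]
      exact Submodule.finrank_eq_zero.mp (FuzzySphere.finrank_spinEigen hlam 0).2
    · exact FuzzySphere.eigenspace_eq_bot_of_iSup_eq_top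
        (μ := fun p : ℕ × ℤˣ => FuzzySphere.eigenvalue p.1 p.2) (fun _ => inf_le_left)
        (FuzzySphere.iSup_spinEigen hlam) fun p hp => h ⟨p, hp⟩
  · rintro ⟨l, s, hls, rfl⟩
    rw [Module.End.hasEigenvalue_iff, FuzzySphere.eigenspace_eq_spinEigen hlam]
    rcases Int.units_eq_one_or s with rfl | rfl
    · exact FuzzySphere.spinEigen_one_ne_bot hlam
        (Nat.one_le_iff_ne_zero.mpr fun h => hls (by rw [h]))
    · exact FuzzySphere.spinEigen_neg_one_ne_bot hlam l
  · rw [FuzzySphere.eigenspace_eq_spinEigen hlam]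
    exact ⟨inferInstance, FuzzySphere.finrank_spinEigen_eq_multiplicity hlam l s, inf_le_right⟩
  · rw [FuzzySphere.eigenspace_eq_spinEigen hlam, FuzzySphere.eigenspace_eq_spinEigen hlam,
      FuzzySphere.spinEigen_sup hlam]
  · exact FuzzySphere.disjoint_eigenspace_iDirac l
  · exact FuzzySphere.isTotalSpinIrreducible_eigenspace hlam (n := 2 * l + 1) (by push_cast; ring)
      (FuzzySphere.finrank_spinEigen hlam l).1 (by push_cast; ring)
  · refine FuzzySphere.isTotalSpinIrreducible_eigenspace hlam (n := 2 * l - 1)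
      (by push_cast; omega) ?_ (by push_cast [show 1 ≤ 2 * l by omega]; ring)
    rw [(FuzzySphere.finrank_spinEigen hlam l).2]
    omega
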